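/- Let $m\ge 2$, $n\ge 3$, $G=SL_m$, $\mathcal K=\mathbb R((t))$, $\mathcal O=\mathbb R[[t]]$, let $\mathcal K_{>0}\subset\mathcal K$ be the semifield of Laurent series with positive leading coefficient, and let $S$ be the disc with $n$ marked points. A principal flag over a field is a point $F\in G/U$, represented by (a lift) $g\in G$ with columns $v_1,\dots,v_m$, where only the forms $v_1\wedge\dots\wedge v_k$ matter. For $i+j+k=m$ with $0\le i,j,k<m$ and flags with lifts $(u_a),(v_a),(w_a)$ put $f_{ijk}=\det(u_1,\dots,u_i,v_1,\dots,v_j,w_1,\dots,w_k)$. The functions $f_{ijk}(F_p,F_q,F_r)$ for the triangles $p<q<r$ of a triangulation of the $n$-gon form a chart of the positive variety $\mathcal A_{G,S}$ of twisted cyclic configurations of $n$ principal flags; a configuration $(F_1,\dots,F_n)$ over $\mathcal K$ (resp. $\mathbb R$) is positive if its coordinates in some such chart lie in $\mathcal K_{>0}$ (resp. $\mathbb R_{>0}$). A tropical point in $\mathcal A_{G,S}(\mathbb Z^t)$ is a family of integer coordinates in all these charts that is compatible with the tropicalizations ($+,\cdot,/$ replaced by $\max,+,-$) of the subtraction-free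 transition functions. For points $x,y,z$ of the affine Grassmannian $G(\mathcal K)/G(\mathcal O)$, viewed as $\mathcal O$-lattices in $\mathcal K^m$, let $f^t_{ijk}(x,y,z)$ be the largest value of $-\mathrm{val}\det(u_1,\dots,u_i,v_1,\dots,v_j,w_1,\dots,w_k)$ with all $u_a\in x$, $v_a\in y$, $w_a\in z$. Lifts of flags are good if, for every triangle $p<q<r$ of some triangulation and all $i,j,k$, $f^t_{ijk}(x_p,x_q,x_r)=-\mathrm{val}f_{ijk}(F_p,F_q,F_r)$, where $x_p$ is the lattice spanned by the lift of $F_p$. For a positive configuration of flags $F_i$ over $\mathcal K$, lifts $v_{i1},\dots,v_{im}$, and coweights $l_i=(l_{i1},\dots,l_{im})\in\mathbb Z^m$ with $\sum_a l_{ia}=0$, such that the vectors $t^{-l_{ia}}v_{ia}$ form good lifts (of the flags $F_i\cdot l_i$) and span lattices $x_i$, the points $x_1,\dots,x_n$ are called a positive configuration and $(x_i,-l_i)$ is said to belong to the family of $(F_i)$. A virtual positive configuration $(x_i,\lambda_i)$ consists of a positive configuration $x_1,\dots,x_n$ and arbitrary coweights $\lambda_i$; put $$f^t_{ijk}((x_p,\lambda_p),(x_q,\lambda_q),(x_r,\lambda_r))=f^t_{ijk}(x_p,x_q,x_r)+\lambda_p\cdot\omega_i+\lambda_q\cdot\omega_j+\lambda_r\cdot\omega_k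 ,$$ where $\lambda\cdot\omega_i$ is the sum of the first $i$ entries of $\lambda$. Proposition. Let $(x_i,\lambda_i)_{i=1}^n$ be a virtual positive configuration in the affine Grassmannian of $SL_m$. Then the integers $f^t_{ijk}((x_p,\lambda_p),(x_q,\lambda_q),(x_r,\lambda_r))$, $p<q<r$, $i+j+k=m$, $0\le i,j,k<m$, satisfy all the tropical relations of $\mathcal A_{G,S}$: (1) if $P,Q$ are subtraction-free expressions in variables indexed by all $(p,q,r;i,j,k)$ and $P=Q$ holds for the functions $f_{ijk}(F_p,F_q,F_r)$ on the positive real points of $\mathcal A_{G,S}$, then the tropicalizations of $P$ and $Q$ agree at these integers; (2) these integers are the coordinates of a tropical point of $\mathcal A_{G,S}(\mathbb Z^t)$ (hence they satisfy every relation satisfied by all tropical points). (3) There is a positive configuration of flags $(F_i)$ over $\mathcal K$ to whose family $(x_i,\lambda_i)$ belongs, and for every such $(F_i)$ and all $p<q<r$ and $i,j,k$ one has $f_{ijk}(F_p,F_q,F_r)\in\mathcal K_{>0}$ and $f^t_{ijk}((x_p,\lambda_p),(x_q,\lambda_q),(x_r,\lambda_r))=-\mathrm{val}\, f_{ijk}(F_p,F_q,F_r)$.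 -/

import Mathlib

open scoped LaurentSeries PowerSeries

noncomputable section

namespace HigherLaminations

/-! ### Principal flags and the triple functions -/

/-- Upper triangular matrices of determinant one with all diagonal entries equal to one.
Right multiplication of `g` by such a matrix adds to each column of `g` a combination of
the preceding columns. -/
def unipotent (m : ℕ) (k : Type) [Field k] :
    Subgroup (Matrix.SpecialLinearGroup (Fin m) k) where
  carrier := {u | (∀ a b, b < a → u.1 a b = 0) ∧ ∀ a, u.1 a a = 1}
  one_mem' := ⟨fun a b h => by simp [h.ne'], fun a => by simp⟩
  mul_mem' := by
    rintro u v ⟨hu, hu1⟩ ⟨hv, hv1⟩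
    refine ⟨fun a b hab => ?_, fun a => ?_⟩
    · simp only [Matrix.SpecialLinearGroup.coe_mul, Matrix.mul_apply]
      refine Finset.sum_eq_zero fun c _ => ?_
      rcases lt_or_ge c a with h | h
      · rw [hu a c h, zero_mul]
      · rw [hv c b (lt_of_lt_of_le hab h), mul_zero]
    · simp only [Matrix.SpecialLinearGroup.coe_mul, Matrix.mul_apply]
      rw [Finset.sum_eq_single a, hu1, hv1, one_mul]
      · intro c _ hc
        rcases lt_or_gt_of_ne hc with h | h
        · rw [hu a c h, zero_mul]
        · rw [hv c a h, mul_zero]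
      · simp
  inv_mem' := by
    rintro u ⟨hu, hu1⟩
    have htri : Matrix.BlockTriangular u.1 id := fun a b h => hu a b h
    have hdet : IsUnit u.1.det := by rw [u.2]; exact isUnit_one
    have hinv : (u⁻¹).1 = (u.1)⁻¹ := by
      refine (Matrix.inv_eq_left_inv ?_).symm
      rw [← Matrix.SpecialLinearGroup.coe_mul, inv_mul_cancel,
        Matrix.SpecialLinearGroup.coe_one]
    let _ : Invertible u.1 := Matrix.invertibleOfIsUnitDet _ hdet
    have htri' : Matrix.BlockTriangular (u.1)⁻¹ id :=
      Matrix.blockTriangular_inv_of_blockTriangular htri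
    have hz : ∀ a b, b < a → (u⁻¹).1 a b = 0 := fun a b h => by
      rw [hinv]; exact htri' h
    refine ⟨hz, fun a => ?_⟩
    have h1 : ((u⁻¹ * u).1) a a = 1 := by rw [inv_mul_cancel]; simp
    rw [Matrix.SpecialLinearGroup.coe_mul, Matrix.mul_apply, Finset.sum_eq_single a, hu1,
      mul_one] at h1
    · exact h1
    · intro c _ hc
      rcases lt_or_gt_of_ne hc with h | h
      · rw [hz a c h, zero_mul]
      · rw [hu c a h, mul_zero]
    · simp

/-- A principal flag for `SL_m`, a point of `G/U`.  The flag of `g` with columns `v₁, …, v_m`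
records exactly the forms `v₁ ∧ ⋯ ∧ v_k`; the matrices `g` in the class are its lifts. -/
abbrev PrincipalFlag (m : ℕ) (k : Type) [Field k] : Type :=
  Matrix.SpecialLinearGroup (Fin m) k ⧸ unipotent m k

/-- Triples `i + j + k = m` of natural numbers, each strictly less than `m`. -/
structure TriWeight (m : ℕ) where
  i : ℕ
  j : ℕ
  k : ℕ
  sum_eq : i + j + k = m
  i_lt : i < m
  j_lt : j < m
  k_lt : k < m

/-- The matrix whose columns are the first `i` columns of `U`, the first `j` columns of `V`,
and the first `k` columns of `W`, in this order. -/
def triMatrix {m : ℕ} {k : Type} (w : TriWeight m) (U V W : Matrix (Fin m) (Fin m) k) :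
    Matrix (Fin m) (Fin m) k := fun r c =>
  if c.1 < w.i then U r c
  else if c.1 < w.i + w.j then V r ⟨c.1 - w.i, lt_of_le_of_lt (Nat.sub_le _ _) c.2⟩
  else W r ⟨c.1 - (w.i + w.j), lt_of_le_of_lt (Nat.sub_le _ _) c.2⟩

/-- `det(u₁, …, u_i, v₁, …, v_j, w₁, …, w_k)`. -/
def triDet {m : ℕ} {k : Type} [CommRing k] (w : TriWeight m)
    (U V W : Matrix (Fin m) (Fin m) k) : k :=
  (triMatrix w U V W).det

theorem sum_shift {m : ℕ} {k : Type} [Field k] (f g : Fin m → k) (s t : ℕ)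
    (b : ℕ) (hb : s + b < t) (ht : t ≤ m)
    (hf : ∀ c : Fin m, b < c.1 → f c = 0)
    (hg : ∀ c : Fin m, c.1 < s ∨ t ≤ c.1 → g c = 0)
    (hfg : ∀ (c d : Fin m), d.1 = s + c.1 → d.1 < t → f c = g d) :
    ∑ c, f c = ∑ d, g d := by
  refine Finset.sum_bij_ne_zero
    (fun c _ hc => (⟨s + c.1, by
      have := not_lt.1 (mt (hf c) hc); omega⟩ : Fin m)) (fun _ _ _ => Finset.mem_univ _)
    ?_ ?_ ?_
  · intro a _ _ a' _ _ h
    simp only [Fin.mk.injEq] at h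
    exact Fin.ext (by omega)
  · intro d _ hd
    have h := mt (hg d) hd
    push Not at h
    refine ⟨⟨d.1 - s, by omega⟩, Finset.mem_univ _, ?_, ?_⟩
    · rw [hfg _ d (by simp only []; omega) h.2]; exact hd
    · exact Fin.ext (by simp only []; omega)
  · intro c _ hc
    have := not_lt.1 (mt (hf c) hc)
    exact hfg c _ rfl (by simp only []; omega)

theorem triDet_mul {m : ℕ} {k : Type} [Field k] (w : TriWeight m)
    (U V W : Matrix (Fin m) (Fin m) k)
    (a b c : Matrix.SpecialLinearGroup (Fin m) k)
    (ha : a ∈ unipotent m k) (hb : b ∈ unipotent m k) (hc : c ∈ unipotent m k) :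
    triDet w (U * a.1) (V * b.1) (W * c.1) = triDet w U V W := by
  obtain ⟨ha0, ha1⟩ := ha
  obtain ⟨hb0, hb1⟩ := hb
  obtain ⟨hc0, hc1⟩ := hc
  have hs := w.sum_eq
  let D : Matrix (Fin m) (Fin m) k := fun x y =>
    if y.1 < w.i then a.1 x y
    else if y.1 < w.i + w.j then
      if x.1 < w.i then 0
      else b.1 ⟨x.1 - w.i, lt_of_le_of_lt (Nat.sub_le _ _) x.2⟩
        ⟨y.1 - w.i, lt_of_le_of_lt (Nat.sub_le _ _) y.2⟩
    else
      if x.1 < w.i + w.j then 0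
      else c.1 ⟨x.1 - (w.i + w.j), lt_of_le_of_lt (Nat.sub_le _ _) x.2⟩
        ⟨y.1 - (w.i + w.j), lt_of_le_of_lt (Nat.sub_le _ _) y.2⟩
  have hD0 : ∀ x y : Fin m, y < x → D x y = 0 := by
    intro x y h
    have h' : y.1 < x.1 := h
    simp only [D]
    split_ifs with h1 h2 h3 h4
    · exact ha0 _ _ h
    · rfl
    · exact hb0 _ _ (by simp only [Fin.lt_def]; omega)
    · rfl
    · exact hc0 _ _ (by simp only [Fin.lt_def]; omega)
  have hD1 : ∀ x : Fin m, D x x = 1 := by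
    intro x
    simp only [D]
    split_ifs with h1 h2
    · exact ha1 _
    · exact hb1 _
    · exact hc1 _
  have hDdet : D.det = 1 := by
    have htri : D.IsUpperTriangular := fun x y h => hD0 x y h
    rw [Matrix.det_of_isUpperTriangular htri]
    simp [hD1]
  have hM : triMatrix w (U * a.1) (V * b.1) (W * c.1) = triMatrix w U V W * D := by
    ext r y
    rw [Matrix.mul_apply]
    by_cases h1 : y.1 < w.i
    · have e : triMatrix w (U * a.1) (V * b.1) (W * c.1) r y = (U * a.1) r y := by
        simp [triMatrix, h1]
      rw [e, Matrix.mul_apply]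
      refine Finset.sum_congr rfl fun x _ => ?_
      by_cases h : y < x
      · rw [hD0 x y h, ha0 x y h]; simp
      · have h' : x.1 ≤ y.1 := by simpa using h
        have h2 : x.1 < w.i := by omega
        simp [triMatrix, D, h1, h2]
    · by_cases h2 : y.1 < w.i + w.j
      · have e : triMatrix w (U * a.1) (V * b.1) (W * c.1) r y
            = (V * b.1) r ⟨y.1 - w.i, lt_of_le_of_lt (Nat.sub_le _ _) y.2⟩ := by
          simp [triMatrix, h1, h2]
        rw [e, Matrix.mul_apply]
        refine sum_shift _ _ w.i (w.i + w.j) (y.1 - w.i) (by omega) (by omega) ?_ ?_ ?_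
        · intro x hx
          rw [hb0 _ _ (by simpa [Fin.lt_def] using hx), mul_zero]
        · rintro x (hx | hx)
          · simp [D, h1, h2, hx]
          · rw [hD0 x y (by simp only [Fin.lt_def]; omega), mul_zero]
        · intro x d hd hd'
          have h3 : ¬ d.1 < w.i := by omega
          have h4 : (⟨d.1 - w.i, lt_of_le_of_lt (Nat.sub_le _ _) d.2⟩ : Fin m) = x :=
            Fin.ext (by simp only []; omega)
          simp [triMatrix, D, h1, h2, h3, hd', h4]
      · have e : triMatrix w (U * a.1) (V * b.1) (W * c.1) r y
            = (W * c.1) r ⟨y.1 - (w.i + w.j), lt_of_le_of_lt (Nat.sub_le _ _) y.2⟩ := by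
          simp [triMatrix, h1, h2]
        have hy := y.2
        rw [e, Matrix.mul_apply]
        refine sum_shift _ _ (w.i + w.j) m (y.1 - (w.i + w.j)) (by omega) le_rfl ?_ ?_ ?_
        · intro x hx
          rw [hc0 _ _ (by simpa [Fin.lt_def] using hx), mul_zero]
        · rintro x (hx | hx)
          · simp [D, h1, h2, hx]
          · exact absurd x.2 (by omega)
        · intro x d hd hd'
          have h3 : ¬ d.1 < w.i := by omega
          have h5 : ¬ d.1 < w.i + w.j := by omega
          have h4 : (⟨d.1 - (w.i + w.j), lt_of_le_of_lt (Nat.sub_le _ _) d.2⟩ : Fin m) = x :=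
            Fin.ext (by simp only []; omega)
          simp [triMatrix, D, h1, h2, h3, h5, h4]
  rw [triDet, hM, Matrix.det_mul, hDdet, mul_one, triDet]

/-- The invariant `f_{ijk}(F₁, F₂, F₃)` of three principal flags, computed on any lifts. -/
def flagTriple {m : ℕ} {k : Type} [Field k] (w : TriWeight m)
    (F₁ F₂ F₃ : PrincipalFlag m k) : k :=
  Quotient.liftOn F₁ (fun g₁ =>
    Quotient.liftOn₂ F₂ F₃ (fun g₂ g₃ => triDet w g₁.1 g₂.1 g₃.1) (by
      intro g₂ g₃ h₂ h₃ e₂ e₃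
      have e₂ : g₂⁻¹ * h₂ ∈ unipotent m k := QuotientGroup.leftRel_apply.1 e₂
      have e₃ : g₃⁻¹ * h₃ ∈ unipotent m k := QuotientGroup.leftRel_apply.1 e₃
      have := triDet_mul w g₁.1 g₂.1 g₃.1 1 _ _ (one_mem _) e₂ e₃
      rw [← Matrix.SpecialLinearGroup.coe_mul, ← Matrix.SpecialLinearGroup.coe_mul,
        ← Matrix.SpecialLinearGroup.coe_mul, mul_inv_cancel_left, mul_inv_cancel_left,
        mul_one] at this
      exact this.symm)) (by
    intro g₁ h₁ e₁
    have e₁ : g₁⁻¹ * h₁ ∈ unipotent m k := QuotientGroup.leftRel_apply.1 e₁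
    induction F₂ using Quotient.inductionOn
    induction F₃ using Quotient.inductionOn
    rename_i g₂ g₃
    have := triDet_mul w g₁.1 g₂.1 g₃.1 _ 1 1 e₁ (one_mem _) (one_mem _)
    rw [← Matrix.SpecialLinearGroup.coe_mul, ← Matrix.SpecialLinearGroup.coe_mul,
      ← Matrix.SpecialLinearGroup.coe_mul, mul_inv_cancel_left, mul_one, mul_one] at this
    exact this.symm)

theorem flagTriple_mk {m : ℕ} {k : Type} [Field k] (w : TriWeight m)
    (g₁ g₂ g₃ : Matrix.SpecialLinearGroup (Fin m) k) :
    flagTriple w (g₁ : PrincipalFlag m k) g₂ g₃ = triDet w g₁.1 g₂.1 g₃.1 := rfl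

/-! ### Triangulations, charts and positive configurations of flags -/

/-- For `p < q` and `r < s`, the segments `pq` and `rs` of a convex polygon whose vertices are
numbered in cyclic order cross exactly when `e` and `e'` satisfy this relation in one of the
two orders. -/
def Crosses {n : ℕ} (e e' : Fin n × Fin n) : Prop :=
  e.1 < e'.1 ∧ e'.1 < e.2 ∧ e.2 < e'.2

/-- A triangulation of the convex `n`-gon without new vertices: a maximal set of pairwise
noncrossing segments joining vertices (the sides of the polygon belong to it by maximality). -/
structure Triangulation (n : ℕ) where
  edges : Set (Fin n × Fin n)
  lt_of_mem : ∀ e ∈ edges, e.1 < e.2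
  noncrossing : ∀ e ∈ edges, ∀ e' ∈ edges, ¬ Crosses e e'
  maximal : ∀ e : Fin n × Fin n, e.1 < e.2 →
    (∀ e' ∈ edges, ¬ Crosses e e' ∧ ¬ Crosses e' e) → e ∈ edges

/-- An index `(p, q, r; i, j, k)` of a function `f_{ijk}(F_p, F_q, F_r)` on configurations of
`n` flags. -/
structure CoordIdx (m n : ℕ) where
  p : Fin n
  q : Fin n
  r : Fin n
  p_lt_q : p < q
  q_lt_r : q < r
  w : TriWeight m

/-- The edge and face functions of the triangles of a triangulation.  An edge function occurs
once for each triangle that contains the edge. -/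
def Triangulation.chart {n : ℕ} (m : ℕ) (T : Triangulation n) : Set (CoordIdx m n) :=
  {a | (a.p, a.q) ∈ T.edges ∧ (a.q, a.r) ∈ T.edges ∧ (a.p, a.r) ∈ T.edges}

/-- The value `f_{ijk}(F_p, F_q, F_r)`. -/
def flagCoord {m n : ℕ} {k : Type} [Field k] (F : Fin n → PrincipalFlag m k)
    (a : CoordIdx m n) : k :=
  flagTriple a.w (F a.p) (F a.q) (F a.r)

/-- The configuration of flags `F` is a point of `A_{G,S}` (`G = SL_m`, `S` a disc with `n`
marked points) with values in the semifield `pos ⊆ k`: its coordinates in one of the charts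
given by triangulations lie in `pos`.  The twisted cyclic configuration is given by its members
`F_0, …, F_{n-1}`, continued by `F_{p+n} = (-1)^(m-1) F_p`. -/
def IsPositiveFlags {m n : ℕ} {k : Type} [Field k] (pos : Set k)
    (F : Fin n → PrincipalFlag m k) : Prop :=
  ∃ T : Triangulation n, ∀ a ∈ T.chart m, flagCoord F a ∈ pos

/-- The semifield of Laurent series with positive leading coefficient. -/
def positiveLaurent : Set ℝ⸨X⸩ := {f | 0 < f.leadingCoeff}

/-! ### Subtraction-free relations and tropical points -/

/-- Formal subtraction-free expressions in variables indexed by `ι`. -/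
inductive SubtractionFree (ι : Type) : Type
  | var : ι → SubtractionFree ι
  | one : SubtractionFree ι
  | add : SubtractionFree ι → SubtractionFree ι → SubtractionFree ι
  | mul : SubtractionFree ι → SubtractionFree ι → SubtractionFree ι
  | div : SubtractionFree ι → SubtractionFree ι → SubtractionFree ι

/-- The value of a subtraction-free expression in a field. -/
def SubtractionFree.eval {ι k : Type} [Field k] (v : ι → k) : SubtractionFree ι → k
  | .var a => v a
  | .one => 1
  | .add P Q => P.eval v + Q.eval v
  | .mul P Q => P.eval v * Q.eval v
  | .div P Q => P.eval v / Q.eval v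

/-- The value of the tropicalization in the tropical semifield of integers: addition,
multiplication and division become maximum, addition and subtraction. -/
def SubtractionFree.trop {ι : Type} (v : ι → ℤ) : SubtractionFree ι → ℤ
  | .var a => v a
  | .one => 0
  | .add P Q => max (P.trop v) (Q.trop v)
  | .mul P Q => P.trop v + Q.trop v
  | .div P Q => P.trop v - Q.trop v

/-- `P = Q` is a relation between the functions `f_{ijk}(F_p, F_q, F_r)` on `A_{G,S}`: it holds
on the space of positive real points of `A_{G,S}`. -/
def IsRelation {m n : ℕ} (P Q : SubtractionFree (CoordIdx m n)) : Prop :=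
  ∀ F : Fin n → PrincipalFlag m ℝ, IsPositiveFlags (Set.Ioi 0) F →
    P.eval (flagCoord F) = Q.eval (flagCoord F)

/-- The subtraction-free expression `R` in the coordinates of the chart of `T` expresses the
function with index `a` on `A_{G,S}`. -/
def IsTransition {m n : ℕ} (T : Triangulation n) (a : CoordIdx m n)
    (R : SubtractionFree (T.chart m)) : Prop :=
  ∀ F : Fin n → PrincipalFlag m ℝ, IsPositiveFlags (Set.Ioi 0) F →
    flagCoord F a = R.eval (fun b => flagCoord F b.1)

/-- A tropical point of `A_{G,S}` with integer coordinates: integer coordinates in every chart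
that are related by the tropicalized transition functions. -/
structure TropicalPoint (m n : ℕ) where
  coord : (T : Triangulation n) → T.chart m → ℤ
  transition : ∀ (T T' : Triangulation n) (a : T'.chart m) (R : SubtractionFree (T.chart m)),
    IsTransition T a.1 R → coord T' a = R.trop (coord T)

/-! ### The affine Grassmannian and the tropical triple functions -/

/-- The `ℝ⟦X⟧`-submodule of `ℝ⸨X⸩^m` spanned by the columns of `g`. -/
def columnSpan {m : ℕ} (g : Matrix.SpecialLinearGroup (Fin m) ℝ⸨X⸩) :
    Submodule ℝ⟦X⟧ (Fin m → ℝ⸨X⸩) :=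
  Submodule.span ℝ⟦X⟧ (Set.range fun c => fun r => g.1 r c)

/-- The affine Grassmannian `SL_m(ℝ⸨X⸩)/SL_m(ℝ⟦X⟧)`, as the set of lattices that have a basis
of determinant one. -/
def AffineGrassmannian (m : ℕ) : Type :=
  {L : Submodule ℝ⟦X⟧ (Fin m → ℝ⸨X⸩) // ∃ g, L = columnSpan g}

/-- The point of the affine Grassmannian given by `g`. -/
def latticeOf {m : ℕ} (g : Matrix.SpecialLinearGroup (Fin m) ℝ⸨X⸩) : AffineGrassmannian m :=
  ⟨columnSpan g, g, rfl⟩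

/-- The values of `-val (det(u₁, …, u_i, v₁, …, v_j, w₁, …, w_k))` for vectors `u`, `v`, `w` in
the lattices `x`, `y`, `z`.  Zero determinants, where the value is `-∞`, are left out. -/
def tripleValues {m : ℕ} (w : TriWeight m) (x y z : AffineGrassmannian m) : Set ℤ :=
  {d | ∃ U V W : Matrix (Fin m) (Fin m) ℝ⸨X⸩,
    (∀ c, (fun r => U r c) ∈ x.1) ∧ (∀ c, (fun r => V r c) ∈ y.1) ∧
    (∀ c, (fun r => W r c) ∈ z.1) ∧
    triDet w U V W ≠ 0 ∧ d = -(triDet w U V W).order}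

/-- The tropical triple function `f^t_{ijk}(x, y, z)`, the largest of the above values. -/
def tripleDist {m : ℕ} (w : TriWeight m) (x y z : AffineGrassmannian m) : ℤ :=
  sSup (tripleValues w x y z)

theorem exists_pow_mul_mem {ι : Type} [Finite ι] (f : ι → ℝ⸨X⸩) :
    ∃ N : ℕ, ∀ a, (algebraMap ℝ⟦X⟧ ℝ⸨X⸩ PowerSeries.X) ^ N * f a ∈
      (algebraMap ℝ⟦X⟧ ℝ⸨X⸩).range := by
  have h1 : ∀ u : ℝ⸨X⸩, ∃ N : ℕ, (algebraMap ℝ⟦X⟧ ℝ⸨X⸩ PowerSeries.X) ^ N * u ∈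
      (algebraMap ℝ⟦X⟧ ℝ⸨X⸩).range := by
    intro u
    obtain ⟨⟨p, s⟩, hs⟩ := IsLocalization.surj (Submonoid.powers (PowerSeries.X : ℝ⟦X⟧)) u
    obtain ⟨N, hN⟩ := s.2
    refine ⟨N, p, ?_⟩
    simp only at hs hN
    rw [← map_pow, hN, ← hs, mul_comm]
  choose N hN using h1
  have := Fintype.ofFinite ι
  refine ⟨∑ a, N (f a), fun a => ?_⟩
  have hle : N (f a) ≤ ∑ a, N (f a) :=
    Finset.single_le_sum (f := fun a => N (f a)) (fun _ _ => Nat.zero_le _) (Finset.mem_univ a)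
  rw [← Nat.sub_add_cancel hle, pow_add, mul_assoc]
  exact mul_mem (pow_mem (RingHom.mem_range_self _ _) _) (hN _)

theorem exists_pow_mul_mem_of_lattice {m : ℕ} (x : AffineGrassmannian m) :
    ∃ N : ℕ, ∀ v ∈ x.1, ∀ r, (algebraMap ℝ⟦X⟧ ℝ⸨X⸩ PowerSeries.X) ^ N * v r ∈
      (algebraMap ℝ⟦X⟧ ℝ⸨X⸩).range := by
  obtain ⟨L, g, rfl⟩ := x
  obtain ⟨N, hN⟩ := exists_pow_mul_mem (fun a : Fin m × Fin m => g.1 a.1 a.2)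
  refine ⟨N, fun v hv => ?_⟩
  change v ∈ columnSpan g at hv
  unfold columnSpan at hv
  induction hv using Submodule.span_induction with
  | mem u hu =>
    obtain ⟨c, rfl⟩ := hu
    exact fun r => hN (r, c)
  | zero => intro r; rw [Pi.zero_apply, mul_zero]; exact zero_mem _
  | add u v _ _ hu hv =>
    intro r
    rw [Pi.add_apply, mul_add]
    exact add_mem (hu r) (hv r)
  | smul s v _ hv =>
    intro r
    rw [Pi.smul_apply, Algebra.smul_def, mul_left_comm]
    exact mul_mem (RingHom.mem_range_self _ _) (hv r)

theorem exists_pow_single_mem_lattice {m : ℕ} (x : AffineGrassmannian m) :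
    ∃ N : ℕ, ∀ c : Fin m, (fun r => if r = c then
      (algebraMap ℝ⟦X⟧ ℝ⸨X⸩ PowerSeries.X) ^ N else 0) ∈ x.1 := by
  obtain ⟨L, g, rfl⟩ := x
  obtain ⟨N, hN⟩ := exists_pow_mul_mem (fun a : Fin m × Fin m => (g⁻¹).1 a.1 a.2)
  refine ⟨N, fun c => ?_⟩
  choose p hp using hN
  have h : (fun r => if r = c then (algebraMap ℝ⟦X⟧ ℝ⸨X⸩ PowerSeries.X) ^ N else 0) =
      ∑ d : Fin m, p (d, c) • (fun r => g.1 r d) := by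
    funext r
    rw [Finset.sum_apply]
    simp only [Pi.smul_apply, Algebra.smul_def, hp]
    have h1 : (g * g⁻¹).1 r c = if r = c then 1 else 0 := by
      rw [mul_inv_cancel, Matrix.SpecialLinearGroup.coe_one, Matrix.one_apply]
    rw [Matrix.SpecialLinearGroup.coe_mul, Matrix.mul_apply] at h1
    calc _ = (algebraMap ℝ⟦X⟧ ℝ⸨X⸩ PowerSeries.X) ^ N * (if r = c then 1 else 0) := by
            split_ifs <;> simp
      _ = _ := by
            rw [← h1, Finset.mul_sum]
            exact Finset.sum_congr rfl fun d _ => by ring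
  change _ ∈ columnSpan g
  rw [h]
  exact Submodule.sum_mem _ fun d _ =>
    Submodule.smul_mem _ _ (Submodule.subset_span ⟨d, rfl⟩)

theorem neg_le_order {N : ℕ} {d : ℝ⸨X⸩} (hd : d ≠ 0)
    (h : (algebraMap ℝ⟦X⟧ ℝ⸨X⸩ PowerSeries.X) ^ N * d ∈ (algebraMap ℝ⟦X⟧ ℝ⸨X⸩).range) :
    -(N : ℤ) ≤ d.order := by
  obtain ⟨p, hp⟩ := h
  have hX : algebraMap ℝ⟦X⟧ ℝ⸨X⸩ PowerSeries.X ^ N = HahnSeries.single (N : ℤ) 1 := by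
    rw [← map_pow]
    exact HahnSeries.ofPowerSeries_X_pow N
  rw [hX] at hp
  have hs : (HahnSeries.single (N : ℤ) 1 : ℝ⸨X⸩) ≠ 0 := HahnSeries.single_ne_zero one_ne_zero
  have hne := mul_ne_zero hs hd
  have h1 : (algebraMap ℝ⟦X⟧ ℝ⸨X⸩ p).order = (N : ℤ) + d.order := by
    rw [hp, HahnSeries.order_mul hs hd, HahnSeries.order_single one_ne_zero]
  by_contra hlt
  have hneg : (algebraMap ℝ⟦X⟧ ℝ⸨X⸩ p).order < 0 := by omega
  have hc : (algebraMap ℝ⟦X⟧ ℝ⸨X⸩ p).coeff (algebraMap ℝ⟦X⟧ ℝ⸨X⸩ p).order = 0 := by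
    have := PowerSeries.coeff_coe p (algebraMap ℝ⟦X⟧ ℝ⸨X⸩ p).order
    rw [if_pos hneg] at this
    exact this
  exact (hp ▸ hne) (HahnSeries.coeff_order_eq_zero.1 hc)

/-- The largest value exists: `f^t_{ijk}` is a maximum, not only a formal supremum. -/
theorem tripleDist_isGreatest {m : ℕ} (w : TriWeight m) (x y z : AffineGrassmannian m) :
    IsGreatest (tripleValues w x y z) (tripleDist w x y z) := by
  have hne : (tripleValues w x y z).Nonempty := by
    obtain ⟨N₁, h₁⟩ := exists_pow_single_mem_lattice x
    obtain ⟨N₂, h₂⟩ := exists_pow_single_mem_lattice y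
    obtain ⟨N₃, h₃⟩ := exists_pow_single_mem_lattice z
    have hs := w.sum_eq
    let τ := algebraMap ℝ⟦X⟧ ℝ⸨X⸩ PowerSeries.X
    have hτ : τ ≠ 0 := by
      have := (FaithfulSMul.algebraMap_injective ℝ⟦X⟧ ℝ⸨X⸩).ne PowerSeries.X_ne_zero
      rwa [map_zero] at this
    let cyc : ℕ → Fin m → Fin m := fun s c =>
      ⟨(c.1 + s) % m, Nat.mod_lt _ (lt_of_le_of_lt (Nat.zero_le _) c.2)⟩
    refine ⟨_, fun r c => if r = c then τ ^ N₁ else 0,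
      fun r c => if r = cyc w.i c then τ ^ N₂ else 0,
      fun r c => if r = cyc (w.i + w.j) c then τ ^ N₃ else 0,
      fun c => h₁ c, fun c => h₂ _, fun c => h₃ _, ?_, rfl⟩
    have hD : triMatrix w (fun r c => if r = c then τ ^ N₁ else 0)
        (fun r c => if r = cyc w.i c then τ ^ N₂ else 0)
        (fun r c => if r = cyc (w.i + w.j) c then τ ^ N₃ else 0) =
        Matrix.diagonal (fun c : Fin m => if c.1 < w.i then τ ^ N₁ else
          if c.1 < w.i + w.j then τ ^ N₂ else τ ^ N₃) := by
      ext r c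
      have hc := c.2
      simp only [triMatrix, Matrix.diagonal_apply]
      by_cases h1 : c.1 < w.i
      · simp only [h1, if_true]
        by_cases h : r = c <;> simp [h, h1]
      · by_cases h2 : c.1 < w.i + w.j
        · have e : cyc w.i ⟨c.1 - w.i, lt_of_le_of_lt (Nat.sub_le _ _) c.2⟩ = c := by
            apply Fin.ext
            simp only [cyc]
            rw [Nat.sub_add_cancel (by omega), Nat.mod_eq_of_lt hc]
          simp only [h1, h2, if_true, if_false, e]
          by_cases h : r = c <;> simp [h, h1, h2]
        · have e : cyc (w.i + w.j)
              ⟨c.1 - (w.i + w.j), lt_of_le_of_lt (Nat.sub_le _ _) c.2⟩ = c := by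
            apply Fin.ext
            simp only [cyc]
            rw [Nat.sub_add_cancel (by omega), Nat.mod_eq_of_lt hc]
          simp only [h1, h2, if_false, e]
          by_cases h : r = c <;> simp [h, h1, h2]
    unfold triDet
    rw [hD, Matrix.det_diagonal]
    refine Finset.prod_ne_zero_iff.2 fun c _ => ?_
    split_ifs <;> exact pow_ne_zero _ hτ
  have hbdd : BddAbove (tripleValues w x y z) := by
    obtain ⟨N₁, h₁⟩ := exists_pow_mul_mem_of_lattice x
    obtain ⟨N₂, h₂⟩ := exists_pow_mul_mem_of_lattice y
    obtain ⟨N₃, h₃⟩ := exists_pow_mul_mem_of_lattice z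
    refine ⟨((N₁ + N₂ + N₃) * m : ℕ), ?_⟩
    rintro _ ⟨U, V, W, hU, hV, hW, h0, rfl⟩
    let τ := algebraMap ℝ⟦X⟧ ℝ⸨X⸩ PowerSeries.X
    have hτ : ∀ N, τ ^ N ∈ (algebraMap ℝ⟦X⟧ ℝ⸨X⸩).range := fun N => pow_mem (RingHom.mem_range_self _ _) N
    have hent : ∀ r c, τ ^ (N₁ + N₂ + N₃) * triMatrix w U V W r c ∈
        (algebraMap ℝ⟦X⟧ ℝ⸨X⸩).range := by
      intro r c
      simp only [triMatrix]
      split_ifs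
      · have := mul_mem (hτ (N₂ + N₃)) (h₁ _ (hU c) r)
        rw [← mul_assoc, ← pow_add] at this
        rwa [show N₁ + N₂ + N₃ = N₂ + N₃ + N₁ by ring]
      · have := mul_mem (hτ (N₁ + N₃)) (h₂ _ (hV ⟨c.1 - w.i, by omega⟩) r)
        rw [← mul_assoc, ← pow_add] at this
        rwa [show N₁ + N₂ + N₃ = N₁ + N₃ + N₂ by ring]
      · have := mul_mem (hτ (N₁ + N₂)) (h₃ _ (hW ⟨c.1 - (w.i + w.j), by omega⟩) r)
        rw [← mul_assoc, ← pow_add] at this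
        exact this
    have hdet : τ ^ ((N₁ + N₂ + N₃) * m) * triDet w U V W ∈
        (algebraMap ℝ⟦X⟧ ℝ⸨X⸩).range := by
      choose p hp using hent
      have e : τ ^ (N₁ + N₂ + N₃) • triMatrix w U V W =
          (algebraMap ℝ⟦X⟧ ℝ⸨X⸩).mapMatrix (Matrix.of p) := by
        ext r c : 2
        simpa using (hp r c).symm
      have := Matrix.det_smul (triMatrix w U V W) (τ ^ (N₁ + N₂ + N₃))
      rw [Fintype.card_fin, ← pow_mul, e, ← RingHom.map_det] at this
      exact ⟨_, this⟩
    have := neg_le_order h0 hdet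
    omega
  exact ⟨Int.csSup_mem hne hbdd, fun d hd => le_csSup hbdd hd⟩

/-- Coweights of `SL_m`: integer tuples of sum zero. -/
def Coweight (m : ℕ) : Type := {l : Fin m → ℤ // ∑ c, l c = 0}

instance {m : ℕ} : Neg (Coweight m) := ⟨fun l => ⟨fun c => -l.1 c, by simp [l.2]⟩⟩

/-- The pairing with the fundamental weight `ω_i`: the sum of the first `i` entries. -/
def Coweight.pair {m : ℕ} (l : Coweight m) (i : ℕ) : ℤ :=
  ∑ c : Fin m, if c.1 < i then l.1 c else 0

theorem prod_single {ι : Type} (s : Finset ι) (l : ι → ℤ) :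
    ∏ c ∈ s, (HahnSeries.single (l c) 1 : ℝ⸨X⸩) = HahnSeries.single (∑ c ∈ s, l c) 1 := by
  classical
  induction s using Finset.induction_on with
  | empty => simp
  | insert a s ha ih =>
    rw [Finset.prod_insert ha, Finset.sum_insert ha, ih, HahnSeries.single_mul_single, one_mul]

/-- The diagonal matrix with entries `t^{-l₁}, …, t^{-l_m}`. -/
def Coweight.torus {m : ℕ} (l : Coweight m) : Matrix.SpecialLinearGroup (Fin m) ℝ⸨X⸩ :=
  ⟨Matrix.diagonal fun c => HahnSeries.single (-l.1 c) 1, by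
    rw [Matrix.det_diagonal, prod_single, Finset.sum_neg_distrib, l.2, neg_zero]
    rfl⟩

/-! ### Good lifts and virtual positive configurations -/

/-- The lifts `g` of the flags `F` are good: for every triangle of some triangulation,
`f^t_{ijk}(x_p, x_q, x_r) = -val (f_{ijk}(F_p, F_q, F_r))`, where `x_p` is spanned by the
columns of `g_p`. -/
def IsGoodLift {m n : ℕ} (g : Fin n → Matrix.SpecialLinearGroup (Fin m) ℝ⸨X⸩) : Prop :=
  ∃ T : Triangulation n, ∀ a ∈ T.chart m,
    tripleDist a.w (latticeOf (g a.p)) (latticeOf (g a.q)) (latticeOf (g a.r)) =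
      -(triDet a.w (g a.p).1 (g a.q).1 (g a.r).1).order

/-- The pairs `(x_i, μ_i)` belong to the family of the positive configuration of flags `F`:
there are lifts `v_{i1}, …, v_{im}` of the flags such that, for `l_i = -μ_i`, the vectors
`t^{-l_{i1}} v_{i1}, …, t^{-l_{im}} v_{im}` are a good lift of `F_i · l_i` and span `x_i`. -/
def InFamily {m n : ℕ} (F : Fin n → PrincipalFlag m ℝ⸨X⸩) (x : Fin n → AffineGrassmannian m)
    (μ : Fin n → Coweight m) : Prop :=
  IsPositiveFlags positiveLaurent F ∧
  ∃ g : Fin n → Matrix.SpecialLinearGroup (Fin m) ℝ⸨X⸩,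
    (∀ i, (g i : PrincipalFlag m ℝ⸨X⸩) = F i) ∧
    IsGoodLift (fun i => g i * (-μ i).torus) ∧
    ∀ i, x i = latticeOf (g i * (-μ i).torus)

/-- Positive configurations of points of the affine Grassmannian: those that arise from some
positive configuration of flags through some lifts and some large enough coweights `l_i`. -/
def IsPositivePoints {m n : ℕ} (x : Fin n → AffineGrassmannian m) : Prop :=
  ∃ (F : Fin n → PrincipalFlag m ℝ⸨X⸩) (l : Fin n → Coweight m), InFamily F x (fun i => -l i)

/-- Virtual positive configurations: a positive configuration of points together with arbitrary
coweights. -/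
structure VirtualPositiveConfiguration (m n : ℕ) where
  point : Fin n → AffineGrassmannian m
  coweight : Fin n → Coweight m
  positive : IsPositivePoints point

/-- The extended function
`f^t_{ijk}((x_p, μ_p), (x_q, μ_q), (x_r, μ_r))
  = f^t_{ijk}(x_p, x_q, x_r) + μ_p · ω_i + μ_q · ω_j + μ_r · ω_k`. -/
def VirtualPositiveConfiguration.triple {m n : ℕ} (C : VirtualPositiveConfiguration m n)
    (a : CoordIdx m n) : ℤ :=
  tripleDist a.w (C.point a.p) (C.point a.q) (C.point a.r) +
    (C.coweight a.p).pair a.w.i + (C.coweight a.q).pair a.w.j + (C.coweight a.r).pair a.w.k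

end HigherLaminations

end

/-!
Write `f_{ijlh}(p, q, r, s)` for the determinant of the first `i`, `j`, `l`, `h` columns of lifts of
four flags.  These minors satisfy the octahedron recurrence
`f_{i+1,j,l+1,h} f_{i,j+1,l,h+1} = f_{i+1,j+1,l,h} f_{i,j,l+1,h+1} + f_{i+1,j,l,h+1} f_{i,j+1,l+1,h}`,
a three-term Plücker relation (`quadDet_octahedron`), so the minors of the triangles on one side of
a flip are subtraction-free rational functions of those on the other side, by an induction that
never leaves the square.  Every triangle is reached from one triangulation by such flips
(`Triangulation.forall_of_flip`), hence positivity in one chart implies positivity of all `f_{ijk}`.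

Goodness of lifts spreads in the same way.  Choose generic real changes of basis of the lattices, so
that all determinants of columns of four lattices are as large as possible at the same time
(`exists_generic_bases`).  A lift is good on a triangle exactly when its `f_{ijk}` have the same
order as those of the generic bases.  Both families of minors satisfy the octahedron recurrence.  For
the positive lifts the order of the right-hand side is a minimum, for the generic bases it is at
least that minimum, and generic orders never exceed the given ones; so equality of orders passes
from one side of a flip to the other (`IsTight.exchange`, `IsGoodLift.forall_triangles`).  Together
with the action of the torus this gives `C.triple = -val f_{ijk}(F)` for all triangles.

For the tropical relations, the lifts over `ℝ((t))` are truncated to Laurent polynomials and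
evaluated at small `t > 0`.  This gives real positive configurations whose coordinates are asymptotic
to the leading terms of those of `F` (`exists_real_approximation`).  A subtraction-free expression
in them grows like `t` to the power minus its tropicalization (`SubtractionFree.tendsto_eval`), so
expressions that agree on real positive configurations have equal tropicalizations at `C.triple`.
Transition functions between charts are relations of this kind, which gives the tropical point.
-/

namespace HigherLaminations

/-! ### The three-term Plücker relation and the octahedron recurrence -/

/-- The linear form on the exterior algebra of `k^m` that sends `v₁ ∧ ⋯ ∧ v_m` to its determinant
and vanishes in degrees other than `m`. -/
noncomputable def detForm (k : Type) [Field k] (m : ℕ) :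
    ExteriorAlgebra k (Fin m → k) →ₗ[k] k :=
  ExteriorAlgebra.liftAlternating fun n =>
    if h : n = m then Matrix.detRowAlternating.domDomCongr (finCongr h.symm) else 0

theorem detForm_ιMulti {k : Type} [Field k] {m : ℕ} (v : Fin m → Fin m → k) :
    detForm k m (ExteriorAlgebra.ιMulti k m v) = Matrix.det (Matrix.of v) := by
  rw [detForm, ExteriorAlgebra.liftAlternating_apply_ιMulti]
  simp
  rfl

open ExteriorAlgebra in
theorem detForm_ι_mul_ι_mul {k : Type} [Field k] {c : ℕ} (a : Fin c → Fin (c + 2) → k)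
    (x y : Fin (c + 2) → k) :
    detForm k (c + 2) (ι k x * ι k y * ιMulti k c a) =
      Matrix.det (Matrix.of (Matrix.vecCons x (Matrix.vecCons y a))) := by
  rw [← detForm_ιMulti, ιMulti_succ_apply, ιMulti_succ_apply, mul_assoc]
  rfl

open ExteriorAlgebra in
/-- The three-term Plücker relation.  Modulo the vectors `a` the space has dimension two, where
the relation is an identity between `2 × 2` minors. -/
theorem detForm_plucker {k : Type} [Field k] {c : ℕ} (a : Fin c → Fin (c + 2) → k)
    (x y z t : Fin (c + 2) → k) :
    detForm k (c + 2) (ι k x * ι k z * ιMulti k c a) *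
        detForm k (c + 2) (ι k y * ι k t * ιMulti k c a) =
      detForm k (c + 2) (ι k x * ι k y * ιMulti k c a) *
        detForm k (c + 2) (ι k z * ι k t * ιMulti k c a) +
      detForm k (c + 2) (ι k x * ι k t * ιMulti k c a) *
        detForm k (c + 2) (ι k y * ι k z * ιMulti k c a) := by
  by_cases hφ : ∀ e f, detForm k (c + 2) (ι k e * ι k f * ιMulti k c a) = 0
  · simp [hφ]
  push Not at hφ
  obtain ⟨e, f, hef⟩ := hφ
  have hself : ∀ v, ι k v * ι k v * ιMulti k c a = 0 := fun v => by
    rw [ι_sq_zero, zero_mul]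
  have hswap : ∀ v w, detForm k (c + 2) (ι k v * ι k w * ιMulti k c a) =
      -detForm k (c + 2) (ι k w * ι k v * ιMulti k c a) := fun v w => by
    rw [eq_neg_of_add_eq_zero_left (ι_add_mul_swap v w), neg_mul, map_neg]
  have ha : ∀ v i, detForm k (c + 2) (ι k v * ι k (a i) * ιMulti k c a) = 0 := by
    intro v i
    rw [detForm_ι_mul_ι_mul]
    refine Matrix.det_zero_of_row_eq (i := 1) (j := i.succ.succ) ?_ ?_
    · intro h; simp [Fin.ext_iff] at h
    · ext s; simp
  have hspan : ∀ v : Fin (c + 2) → k, ∃ (α β : k) (s : Fin c → k),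
      v = α • e + β • f + ∑ i, s i • a i := by
    intro v
    set M := Matrix.of (Matrix.vecCons e (Matrix.vecCons f a)) with hM
    have hdet : IsUnit M.det := by
      rw [isUnit_iff_ne_zero, hM, ← detForm_ι_mul_ι_mul]; exact hef
    set s := Matrix.vecMul v M⁻¹ with hs
    refine ⟨s 0, s 1, fun i => s i.succ.succ, ?_⟩
    have h : v = Matrix.vecMul s M := by
      rw [hs, Matrix.vecMul_vecMul, Matrix.nonsing_inv_mul _ hdet, Matrix.vecMul_one]
    conv_lhs => rw [h]
    ext r
    simp [Matrix.vecMul, dotProduct, Fin.sum_univ_succ, hM, add_assoc]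
  have hform : ∀ v, ∃ α β : k, ∀ w,
      detForm k (c + 2) (ι k v * ι k w * ιMulti k c a) =
        α * detForm k (c + 2) (ι k e * ι k w * ιMulti k c a) +
        β * detForm k (c + 2) (ι k f * ι k w * ιMulti k c a) := by
    intro v
    obtain ⟨α, β, s, rfl⟩ := hspan v
    refine ⟨α, β, fun w => ?_⟩
    have h0 : ∀ i, detForm k (c + 2) (ι k (a i) * ι k w * ιMulti k c a) = 0 := fun i => by
      rw [hswap, ha, neg_zero]
    simp [add_mul, Finset.sum_mul, h0]
  have hform' : ∀ v, ∃ α β : k,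
      (∀ w, detForm k (c + 2) (ι k v * ι k w * ιMulti k c a) =
        α * detForm k (c + 2) (ι k e * ι k w * ιMulti k c a) +
        β * detForm k (c + 2) (ι k f * ι k w * ιMulti k c a)) ∧
      detForm k (c + 2) (ι k e * ι k v * ιMulti k c a) =
        β * detForm k (c + 2) (ι k e * ι k f * ιMulti k c a) ∧
      detForm k (c + 2) (ι k f * ι k v * ιMulti k c a) =
        -α * detForm k (c + 2) (ι k e * ι k f * ιMulti k c a) := by
    intro v
    obtain ⟨α, β, h⟩ := hform v
    refine ⟨α, β, h, ?_, ?_⟩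
    · rw [hswap, h, hself, map_zero, hswap f e]; ring
    · rw [hswap, h, hself, map_zero]; ring
  obtain ⟨_, _, hx, -, -⟩ := hform' x
  obtain ⟨_, _, hy, hy1, hy2⟩ := hform' y
  obtain ⟨_, _, hz, hz1, hz2⟩ := hform' z
  obtain ⟨_, _, -, ht1, ht2⟩ := hform' t
  simp only [hx, hy, hz, hy1, hy2, hz1, hz2, ht1, ht2]
  ring

/-- The matrix whose columns are the first `i`, `j`, `l` and `h` columns of `U`, `V`, `W` and `Z`,
in this order. -/
def quadMatrix {m : ℕ} {k : Type} (i j l : ℕ) (U V W Z : Matrix (Fin m) (Fin m) k) :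
    Matrix (Fin m) (Fin m) k := fun r c =>
  if c.1 < i then U r c
  else if c.1 < i + j then V r ⟨c.1 - i, lt_of_le_of_lt (Nat.sub_le _ _) c.2⟩
  else if c.1 < i + j + l then W r ⟨c.1 - (i + j), lt_of_le_of_lt (Nat.sub_le _ _) c.2⟩
  else Z r ⟨c.1 - (i + j + l), lt_of_le_of_lt (Nat.sub_le _ _) c.2⟩

/-- `det(u₁, …, u_i, v₁, …, v_j, w₁, …, w_l, z₁, …, z_h)`, where `h = m - i - j - l`. -/
def quadDet {m : ℕ} {k : Type} [CommRing k] (i j l : ℕ)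
    (U V W Z : Matrix (Fin m) (Fin m) k) : k :=
  (quadMatrix i j l U V W Z).det

/-- The product `u₁ ∧ ⋯ ∧ u_i` of the first `i` columns; missing columns count as zero. -/
noncomputable def colWedge {m : ℕ} {k : Type} [Field k] (U : Matrix (Fin m) (Fin m) k) (i : ℕ) :
    ExteriorAlgebra k (Fin m → k) :=
  ExteriorAlgebra.ιMulti k i fun c r => if h : c.1 < m then U r ⟨c.1, h⟩ else 0

theorem colWedge_zero {m : ℕ} {k : Type} [Field k] (U : Matrix (Fin m) (Fin m) k) :
    colWedge U 0 = 1 := by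
  simp [colWedge]

theorem exists_colWedge_succ {m : ℕ} {k : Type} [Field k] (U : Matrix (Fin m) (Fin m) k) (i : ℕ) :
    ∃ u, colWedge U (i + 1) = colWedge U i * ExteriorAlgebra.ι k u := by
  refine ⟨fun r => if h : i < m then U r ⟨i, h⟩ else 0, ?_⟩
  rw [colWedge, colWedge, ExteriorAlgebra.ιMulti_apply, ExteriorAlgebra.ιMulti_apply,
    List.ofFn_succ', List.concat_eq_append, List.prod_append, List.prod_singleton]
  rfl

theorem colWedge_mul_ι {m : ℕ} {k : Type} [Field k] (U : Matrix (Fin m) (Fin m) k) (i : ℕ)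
    (y : Fin m → k) :
    colWedge U i * ExteriorAlgebra.ι k y =
      ((-1 : k) ^ i) • (ExteriorAlgebra.ι k y * colWedge U i) := by
  induction i with
  | zero => simp [colWedge_zero]
  | succ i ih =>
    obtain ⟨u, hu⟩ := exists_colWedge_succ U i
    rw [hu, mul_assoc, eq_neg_of_add_eq_zero_left (ExteriorAlgebra.ι_add_mul_swap u y), mul_neg,
      ← mul_assoc, ih, pow_succ, smul_mul_assoc, mul_neg_one, neg_smul, mul_assoc]

theorem detForm_colWedge {m : ℕ} {k : Type} [Field k] {i j l h : ℕ} (hs : i + j + l + h = m)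
    (U V W Z : Matrix (Fin m) (Fin m) k) :
    detForm k m (colWedge U i * colWedge V j * colWedge W l * colWedge Z h) =
      quadDet i j l U V W Z := by
  subst hs
  simp only [colWedge]
  rw [ExteriorAlgebra.ιMulti_mul_ιMulti, ExteriorAlgebra.ιMulti_mul_ιMulti,
    ExteriorAlgebra.ιMulti_mul_ιMulti, detForm_ιMulti, quadDet, ← Matrix.det_transpose]
  congr 1
  ext r c
  simp only [Matrix.transpose_apply, Matrix.of_apply, quadMatrix]
  refine Fin.addCases (fun c => ?_) (fun c => ?_) c
  · rw [Fin.append_left]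
    refine Fin.addCases (fun c => ?_) (fun c => ?_) c
    · rw [Fin.append_left]
      refine Fin.addCases (fun c => ?_) (fun c => ?_) c
      · have := c.2
        rw [Fin.append_left, dif_pos (by omega), if_pos (by simp)]
        rfl
      · have := c.2
        rw [Fin.append_right, dif_pos (by omega), if_neg (by simp), if_pos (by simp)]
        congr 1; ext; simp
    · have := c.2
      rw [Fin.append_right, dif_pos (by omega), if_neg (by simp; omega), if_neg (by simp),
        if_pos (by simp)]
      congr 1; ext; simp
  · have := c.2
    rw [Fin.append_right, dif_pos (by omega), if_neg (by simp; omega), if_neg (by simp; omega),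
      if_neg (by simp)]
    congr 1; ext; simp

open ExteriorAlgebra in
/-- The sign of moving two vectors to the front of a product, past factors `A` and `B` that commute
with vectors up to the signs `α` and `β`. -/
theorem detForm_move {m : ℕ} {k : Type} [Field k] {A B C : ExteriorAlgebra k (Fin m → k)}
    {α β : k} (hA : ∀ y, A * ι k y = α • (ι k y * A)) (hB : ∀ y, B * ι k y = β • (ι k y * B))
    (x y : Fin m → k) :
    detForm k m (A * ι k x * (B * ι k y * C)) =
      α * α * β * detForm k m (ι k x * ι k y * (A * B * C)) := by
  rw [← smul_eq_mul (α * α * β), ← map_smul]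
  congr 1
  rw [hA, hB, smul_mul_assoc, smul_mul_assoc, mul_smul_comm, mul_assoc (ι k x),
    mul_assoc (ι k y), ← mul_assoc A, hA, smul_mul_assoc, mul_smul_comm, smul_smul, smul_smul]
  simp only [mul_assoc]
  congr 1; ring

open ExteriorAlgebra in
/-- The octahedron recurrence between the minors of four flags.  Moving the four added columns to
the front produces the same sign in each of the three products. -/
theorem quadDet_octahedron {m : ℕ} {k : Type} [Field k] {i j l h : ℕ}
    (hs : i + j + l + h + 2 = m) (U V W Z : Matrix (Fin m) (Fin m) k) :
    quadDet (i + 1) j (l + 1) U V W Z * quadDet i (j + 1) l U V W Z =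
      quadDet (i + 1) (j + 1) l U V W Z * quadDet i j (l + 1) U V W Z +
      quadDet (i + 1) j l U V W Z * quadDet i (j + 1) (l + 1) U V W Z := by
  rw [← detForm_colWedge (h := h) (by omega), ← detForm_colWedge (h := h + 1) (by omega),
    ← detForm_colWedge (h := h) (by omega), ← detForm_colWedge (h := h + 1) (by omega),
    ← detForm_colWedge (h := h + 1) (by omega), ← detForm_colWedge (h := h) (by omega)]
  obtain ⟨u, hu⟩ := exists_colWedge_succ U i
  obtain ⟨v, hv⟩ := exists_colWedge_succ V j
  obtain ⟨w, hw⟩ := exists_colWedge_succ W l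
  obtain ⟨z, hz⟩ := exists_colWedge_succ Z h
  rw [hu, hv, hw, hz]
  have h1 := colWedge_mul_ι U i
  have h2 := colWedge_mul_ι V j
  have h3 := colWedge_mul_ι W l
  have h4 := colWedge_mul_ι Z h
  have hmul : ∀ {A B : ExteriorAlgebra k (Fin m → k)} {α β : k},
      (∀ y, A * ι k y = α • (ι k y * A)) → (∀ y, B * ι k y = β • (ι k y * B)) →
      ∀ y, A * B * ι k y = (α * β) • (ι k y * (A * B)) := by
    intro A B α β hA hB y
    rw [mul_assoc, hB, mul_smul_comm, ← mul_assoc, hA, smul_mul_assoc, smul_smul, mul_assoc,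
      mul_comm β]
  generalize hU : colWedge U i = U' at *
  generalize hV : colWedge V j = V' at *
  generalize hW : colWedge W l = W' at *
  generalize hZ : colWedge Z h = Z' at *
  have e13 := detForm_move (C := Z') h1 (hmul h2 h3) u w
  have e24 := detForm_move (C := 1) (hmul h1 h2) (hmul h3 h4) v z
  have e12 := detForm_move (C := W' * Z') h1 h2 u v
  have e34 := detForm_move (C := 1) (hmul (hmul h1 h2) h3) h4 w z
  have e14 := detForm_move (C := 1) h1 (hmul (hmul h2 h3) h4) u z
  have e23 := detForm_move (C := Z') (hmul h1 h2) h3 v w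
  simp only [mul_assoc, mul_one] at e13 e24 e12 e34 e14 e23 ⊢
  rw [e13, e24, e12, e34, e14, e23]
  obtain ⟨a, ha⟩ : ∃ a : Fin (i + j + l + h) → Fin m → k,
      U' * (V' * (W' * Z')) = ιMulti k _ a := by
    rw [← hU, ← hV, ← hW, ← hZ, ← mul_assoc, ← mul_assoc]
    simp only [colWedge, ιMulti_mul_ιMulti]
    exact ⟨_, rfl⟩
  have hp : ∀ x y z t : Fin m → k,
      detForm k m (ι k x * ι k z * ιMulti k _ a) * detForm k m (ι k y * ι k t * ιMulti k _ a) =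
      detForm k m (ι k x * ι k y * ιMulti k _ a) * detForm k m (ι k z * ι k t * ιMulti k _ a) +
      detForm k m (ι k x * ι k t * ιMulti k _ a) *
        detForm k m (ι k y * ι k z * ιMulti k _ a) := by
    clear * - hs
    subst hs
    exact detForm_plucker a
  have := hp u v w z
  simp only [mul_assoc] at this
  rw [ha]
  linear_combination (((-1) ^ i) ^ 4 * ((-1) ^ j) ^ 3 * ((-1) ^ l) ^ 2 * (-1) ^ h) * this

/-! ### Positive Laurent series -/

theorem ne_zero_of_positiveLaurent {f : ℝ⸨X⸩} (hf : f ∈ positiveLaurent) : f ≠ 0 := by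
  rintro rfl
  simp [positiveLaurent] at hf

theorem positiveLaurent_mul {f g : ℝ⸨X⸩} (hf : f ∈ positiveLaurent) (hg : g ∈ positiveLaurent) :
    f * g ∈ positiveLaurent := by
  change 0 < (f * g).leadingCoeff
  rw [HahnSeries.leadingCoeff_mul]
  exact mul_pos hf hg

/-- Leading terms of positive series do not cancel, so the order of a sum is the minimum. -/
theorem positiveLaurent_add {f g : ℝ⸨X⸩} (hf : f ∈ positiveLaurent) (hg : g ∈ positiveLaurent) :
    f + g ∈ positiveLaurent ∧ (f + g).orderTop = min f.orderTop g.orderTop := by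
  rcases lt_trichotomy f.orderTop g.orderTop with h | h | h
  · refine ⟨?_, by rw [HahnSeries.orderTop_add_eq_left h, min_eq_left h.le]⟩
    change 0 < (f + g).leadingCoeff
    rw [HahnSeries.leadingCoeff_add_eq_left h]
    exact hf
  · have hf0 := ne_zero_of_positiveLaurent hf
    have hg0 := ne_zero_of_positiveLaurent hg
    have ho : f.order = g.order := by
      rw [← HahnSeries.order_eq_orderTop_of_ne_zero hf0,
        ← HahnSeries.order_eq_orderTop_of_ne_zero hg0] at h
      exact_mod_cast h
    have hc : 0 < (f + g).coeff f.order := by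
      rw [HahnSeries.coeff_add]
      have h1 : 0 < f.leadingCoeff := hf
      have h2 : 0 < g.leadingCoeff := hg
      rw [HahnSeries.leadingCoeff_eq] at h1 h2
      rw [← ho] at h2
      exact add_pos h1 h2
    have hmin : min f.orderTop g.orderTop = f.order := by
      rw [← h, min_self, HahnSeries.order_eq_orderTop_of_ne_zero hf0]
    have ht : (f + g).orderTop = f.order :=
      le_antisymm (HahnSeries.orderTop_le_of_coeff_ne_zero hc.ne')
        (hmin ▸ HahnSeries.min_orderTop_le_orderTop_add)
    refine ⟨?_, ht.trans hmin.symm⟩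
    have hne : f + g ≠ 0 := fun h0 => by simp [h0] at hc
    have hord : (f + g).order = f.order := by
      rw [← HahnSeries.order_eq_orderTop_of_ne_zero hne] at ht
      exact_mod_cast ht
    change 0 < (f + g).leadingCoeff
    rw [HahnSeries.leadingCoeff_eq, hord]
    exact hc
  · refine ⟨?_, by rw [HahnSeries.orderTop_add_eq_right h, min_eq_right h.le]⟩
    change 0 < (f + g).leadingCoeff
    rw [HahnSeries.leadingCoeff_add_eq_right h]
    exact hg

theorem orderTop_mul (f g : ℝ⸨X⸩) : (f * g).orderTop = f.orderTop + g.orderTop :=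
  (HahnSeries.addVal ℤ ℝ).map_mul f g

theorem positiveLaurent_of_mul_right {f g : ℝ⸨X⸩} (hg : g ∈ positiveLaurent)
    (h : f * g ∈ positiveLaurent) : f ∈ positiveLaurent := by
  change 0 < (f * g).leadingCoeff at h
  rw [HahnSeries.leadingCoeff_mul] at h
  exact pos_of_mul_pos_left h (le_of_lt hg)

/-- `f` is positive and `f'` has the same order. -/
def IsTight (f f' : ℝ⸨X⸩) : Prop :=
  f ∈ positiveLaurent ∧ f'.orderTop = f.orderTop

/-- Tightness passes through the exchange relation `x e = a b + c d`: positivity makes the order of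
the right-hand side a minimum for the unprimed elements, and it is at least that minimum for the
primed ones. -/
theorem IsTight.exchange {a b c d e x a' b' c' d' e' x' : ℝ⸨X⸩}
    (ha : IsTight a a') (hb : IsTight b b') (hc : IsTight c c') (hd : IsTight d d')
    (he : IsTight e e') (h : e * x = a * b + c * d) (h' : e' * x' = a' * b' + c' * d')
    (hle : x'.orderTop ≤ x.orderTop) : IsTight x x' := by
  obtain ⟨hp, ho⟩ := positiveLaurent_add (positiveLaurent_mul ha.1 hb.1)
    (positiveLaurent_mul hc.1 hd.1)
  rw [← h] at hp ho
  refine ⟨positiveLaurent_of_mul_right he.1 (by rwa [mul_comm]), le_antisymm hle ?_⟩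
  have h1 := HahnSeries.min_orderTop_le_orderTop_add (x := a' * b') (y := c' * d')
  rw [← h'] at h1
  simp only [orderTop_mul] at ho h1
  rw [ha.2, hb.2, hc.2, hd.2, he.2, ← ho] at h1
  exact (WithTop.add_le_add_iff_left
    (mt HahnSeries.orderTop_eq_top.1
      (ne_zero_of_positiveLaurent he.1))).1 h1

/-- If two arrays satisfy the octahedron recurrence and are tight on the two triangles on one side
of a square, they are tight everywhere.  The induction is on `j + h`, which the recurrence raises by two on one
factor only. -/
theorem IsTight.octahedron {m : ℕ} {f f' : ℕ → ℕ → ℕ → ℕ → ℝ⸨X⸩}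
    (hf : ∀ i j l h, i + j + l + h + 2 = m →
      f (i + 1) j (l + 1) h * f i (j + 1) l (h + 1) =
        f (i + 1) (j + 1) l h * f i j (l + 1) (h + 1) +
        f (i + 1) j l (h + 1) * f i (j + 1) (l + 1) h)
    (hf' : ∀ i j l h, i + j + l + h + 2 = m →
      f' (i + 1) j (l + 1) h * f' i (j + 1) l (h + 1) =
        f' (i + 1) (j + 1) l h * f' i j (l + 1) (h + 1) +
        f' (i + 1) j l (h + 1) * f' i (j + 1) (l + 1) h)
    (hle : ∀ i j l h, i + j + l + h = m → (f' i j l h).orderTop ≤ (f i j l h).orderTop)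
    (h₁ : ∀ i j l, i + j + l = m → i < m → j < m → l < m → IsTight (f i j l 0) (f' i j l 0))
    (h₂ : ∀ i l h, i + l + h = m → i < m → l < m → h < m → IsTight (f i 0 l h) (f' i 0 l h))
    {i j l h : ℕ} (hs : i + j + l + h = m) (hi : i < m) (hj : j < m) (hl : l < m) (hh : h < m) :
    IsTight (f i j l h) (f' i j l h) := by
  induction hN : j + h using Nat.strong_induction_on generalizing i j l h with
  | _ N ih =>
    subst hN
    rcases j with _ | j
    · exact h₂ i l h (by omega) hi hl hh
    rcases h with _ | h
    · exact h₁ i (j + 1) l (by omega) hi hj hl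
    have hs' : i + j + l + h + 2 = m := by omega
    refine IsTight.exchange ?_ ?_ ?_ ?_ ?_ (hf i j l h hs') (hf' i j l h hs') (hle _ _ _ _ hs)
    · exact ih (j + 1 + h) (by omega) (by omega) (by omega) (by omega) (by omega) (by omega) rfl
    · exact ih (j + (h + 1)) (by omega) (by omega) (by omega) (by omega) (by omega) (by omega) rfl
    · exact ih (j + (h + 1)) (by omega) (by omega) (by omega) (by omega) (by omega) (by omega) rfl
    · exact ih (j + 1 + h) (by omega) (by omega) (by omega) (by omega) (by omega) (by omega) rfl
    · exact ih (j + h) (by omega) (by omega) (by omega) (by omega) (by omega) (by omega) rfl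

/-! ### Triangulations and flips -/

/-- An edge `pr` of a triangulation with a vertex between `p` and `r` is the long side of one of its
triangles. -/
theorem Triangulation.exists_triangle {n : ℕ} (T : Triangulation n) {p r : Fin n}
    (hpr : (p, r) ∈ T.edges) (h : p.1 + 1 < r.1) :
    ∃ q, p < q ∧ q < r ∧ (p, q) ∈ T.edges ∧ (q, r) ∈ T.edges := by
  classical
  let s : Finset (Fin n) := Finset.univ.filter fun q => p < q ∧ q < r ∧ (p, q) ∈ T.edges
  have hs : s.Nonempty := by
    refine ⟨⟨p.1 + 1, by omega⟩, ?_⟩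
    simp only [s, Finset.mem_filter, Finset.mem_univ, true_and, Fin.lt_def]
    refine ⟨by omega, by omega, T.maximal _ (by simp [Fin.lt_def]) fun e he => ?_⟩
    have := T.lt_of_mem e he
    simp only [Crosses, Fin.lt_def] at this ⊢
    omega
  -- The third vertex is the last vertex before `r` that is joined to `p`.
  obtain ⟨q, hq, hmax⟩ := s.exists_max_image id hs
  simp only [s, Finset.mem_filter, Finset.mem_univ, true_and, id] at hq hmax
  refine ⟨q, hq.1, hq.2.1, hq.2.2, T.maximal _ hq.2.1 fun e he => ?_⟩
  obtain ⟨a, b⟩ := e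
  have h1 := T.lt_of_mem _ he
  have h2 := T.noncrossing _ he _ hpr
  have h3 := T.noncrossing _ hpr _ he
  have h4 := T.noncrossing _ hq.2.2 _ he
  have h5 := hmax b
  have h6 : a = p → (p, b) ∈ T.edges := by rintro rfl; exact he
  simp only [Crosses, Fin.lt_def, Fin.le_def, Fin.ext_iff] at *
  refine ⟨by omega, fun hc => ?_⟩
  have hap : a.1 = p.1 := by omega
  have := h5 ⟨by omega, by omega, h6 hap⟩
  omega

/-- A property of triangles that spreads under both kinds of flips of a quadrilateral and holds for
the triangles of one triangulation holds for all triangles. -/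
theorem Triangulation.forall_of_flip {n : ℕ} (T : Triangulation n)
    (good : Fin n → Fin n → Fin n → Prop)
    (flip₁ : ∀ p q r s, p < q → q < r → r < s → good p q r → good p r s →
      good p q s ∧ good q r s)
    (flip₂ : ∀ p q r s, p < q → q < r → r < s → good p q s → good q r s →
      good p q r ∧ good p r s)
    (hT : ∀ p q r, p < q → q < r → (p, q) ∈ T.edges → (q, r) ∈ T.edges → (p, r) ∈ T.edges →
      good p q r)
    {p q r : Fin n} (hpq : p < q) (hqr : q < r) : good p q r := by
  have key : ∀ (N : ℕ) (p r : Fin n), r.1 - p.1 ≤ N → (p, r) ∈ T.edges →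
      ∀ a b c, p ≤ a → a < b → b < c → c ≤ r → good a b c := by
    intro N
    induction N with
    | zero =>
      intro p r h _ a b c ha hab hbc hc
      simp only [Fin.lt_def, Fin.le_def] at *
      omega
    | succ N ih =>
      intro p r hN hpr a b c ha hab hbc hc
      obtain ⟨q, hpq, hqr, he₁, he₂⟩ := T.exists_triangle hpr
        (by simp only [Fin.lt_def, Fin.le_def] at *; omega)
      have h₁ := ih p q (by simp only [Fin.lt_def] at *; omega) he₁
      have h₂ := ih q r (by simp only [Fin.lt_def] at *; omega) he₂
      -- Glue the triangle `p q r` to the polygon `p, …, q` along the edge `p q`.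
      have hleft : ∀ a, p ≤ a → a < q → good a q r := by
        intro a ha haq
        rcases ha.eq_or_lt with rfl | hpa
        · exact hT _ _ _ hpq hqr he₁ he₂ hpr
        · exact (flip₁ p a q r hpa haq hqr (h₁ p a q le_rfl hpa haq le_rfl)
            (hT _ _ _ hpq hqr he₁ he₂ hpr)).2
      -- Glue the polygon `q, …, r` along the edge `q r`.
      have hright : ∀ a c, p ≤ a → a < q → q < c → c ≤ r → good a q c := by
        intro a c ha haq hqc hcr
        rcases hcr.eq_or_lt with rfl | hcr
        · exact hleft a ha haq
        · exact (flip₂ a q c r haq hqc hcr (hleft a ha haq)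
            (h₂ q c r le_rfl hqc hcr le_rfl)).1
      rcases le_or_gt c q with hcq | hqc
      · exact h₁ a b c ha hab hbc hcq
      rcases le_or_gt q a with hqa | haq
      · exact h₂ a b c hqa hab hbc hc
      rcases lt_trichotomy b q with hbq | rfl | hqb
      · exact (flip₁ a b q c hab hbq hqc (h₁ a b q ha hab hbq le_rfl)
          (hright a c ha haq hqc hc)).1
      · exact hright a c ha haq hqc hc
      · exact (flip₂ a q b c haq hqb hbc (hright a c ha haq hqc hc)
          (h₂ q b c le_rfl hqb hbc hc)).2
  have hn := r.2
  have hn0 : 0 < n := by omega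
  refine key n ⟨0, hn0⟩ ⟨n - 1, by omega⟩ (by simp only []; omega) ?_ p q r ?_ hpq hqr ?_
  · simp only [Fin.lt_def] at hpq hqr
    refine T.maximal _ (by simp only [Fin.lt_def]; omega) fun e _ => ?_
    simp only [Crosses, Fin.lt_def]
    omega
  · simp [Fin.le_def]
  · simp only [Fin.le_def]; omega

/-! ### Triangles inside quadrilaterals -/

theorem triDet_eq_quadDet₁₂₃ {m : ℕ} {k : Type} [CommRing k] (w : TriWeight m)
    (U V W Z : Matrix (Fin m) (Fin m) k) :
    triDet w U V W = quadDet w.i w.j w.k U V W Z := by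
  have hs := w.sum_eq
  simp only [triDet, quadDet]
  congr 1
  ext r c
  have hc : c.1 < w.i + w.j + w.k := by omega
  simp only [triMatrix, quadMatrix, hc, if_true]

theorem triDet_eq_quadDet₁₃₄ {m : ℕ} {k : Type} [CommRing k] (w : TriWeight m)
    (U V W Z : Matrix (Fin m) (Fin m) k) :
    triDet w U W Z = quadDet w.i 0 w.j U V W Z := by
  simp only [triDet, quadDet]
  congr 1
  ext r c
  simp only [triMatrix, quadMatrix, add_zero]
  split_ifs <;> rfl

theorem triDet_eq_quadDet₁₂₄ {m : ℕ} {k : Type} [CommRing k] (w : TriWeight m)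
    (U V W Z : Matrix (Fin m) (Fin m) k) :
    triDet w U V Z = quadDet w.i w.j 0 U V W Z := by
  simp only [triDet, quadDet]
  congr 1
  ext r c
  simp only [triMatrix, quadMatrix, add_zero]
  split_ifs <;> rfl

theorem triDet_eq_quadDet₂₃₄ {m : ℕ} {k : Type} [CommRing k] (w : TriWeight m)
    (U V W Z : Matrix (Fin m) (Fin m) k) :
    triDet w V W Z = quadDet 0 w.i w.j U V W Z := by
  simp only [triDet, quadDet]
  congr 1
  ext r c
  simp [triMatrix, quadMatrix]

theorem quadDet_map {m : ℕ} {k k' : Type} [CommRing k] [CommRing k'] (φ : k →+* k') (i j l : ℕ)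
    (U V W Z : Matrix (Fin m) (Fin m) k) :
    φ (quadDet i j l U V W Z) = quadDet i j l (U.map φ) (V.map φ) (W.map φ) (Z.map φ) := by
  simp only [quadDet, RingHom.map_det]
  congr 1
  ext r c
  simp only [RingHom.mapMatrix_apply, Matrix.map_apply, quadMatrix]
  split_ifs <;> rfl

theorem triDet_map {m : ℕ} {k k' : Type} [CommRing k] [CommRing k'] (φ : k →+* k')
    (w : TriWeight m) (U V W : Matrix (Fin m) (Fin m) k) :
    φ (triDet w U V W) = triDet w (U.map φ) (V.map φ) (W.map φ) := by
  rw [triDet_eq_quadDet₁₂₃ w U V W W, quadDet_map, ← triDet_eq_quadDet₁₂₃]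

section Flip

variable {m : ℕ} {U V W Z U' V' W' Z' : Matrix (Fin m) (Fin m) ℝ⸨X⸩}

/-- The flip from the diagonal `UW` of the square `U V W Z` to the diagonal `VZ`. -/
theorem IsTight.flip₁
    (hle : ∀ i j l, i + j + l ≤ m →
      (quadDet i j l U' V' W' Z').orderTop ≤ (quadDet i j l U V W Z).orderTop)
    (h₁ : ∀ w, IsTight (triDet w U V W) (triDet w U' V' W'))
    (h₂ : ∀ w, IsTight (triDet w U W Z) (triDet w U' W' Z')) :
    (∀ w, IsTight (triDet w U V Z) (triDet w U' V' Z')) ∧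
      ∀ w, IsTight (triDet w V W Z) (triDet w V' W' Z') := by
  have key : ∀ i j l h, i + j + l + h = m → i < m → j < m → l < m → h < m →
      IsTight (quadDet i j l U V W Z) (quadDet i j l U' V' W' Z') := by
    intro i j l h hs hi hj hl hh
    refine IsTight.octahedron (m := m) (f := fun i j l _ => quadDet i j l U V W Z)
      (f' := fun i j l _ => quadDet i j l U' V' W' Z')
      (fun i j l h hs => quadDet_octahedron hs U V W Z)
      (fun i j l h hs => quadDet_octahedron hs U' V' W' Z')
      (fun i j l h hs => hle i j l (by omega)) ?_ ?_ hs hi hj hl hh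
    · intro i j l hs hi hj hl
      have := h₁ ⟨i, j, l, hs, hi, hj, hl⟩
      rwa [triDet_eq_quadDet₁₂₃ _ U V W Z, triDet_eq_quadDet₁₂₃ _ U' V' W' Z'] at this
    · intro i l h hs hi hl hh
      have := h₂ ⟨i, l, h, hs, hi, hl, hh⟩
      rwa [triDet_eq_quadDet₁₃₄ _ U V W Z, triDet_eq_quadDet₁₃₄ _ U' V' W' Z'] at this
  refine ⟨fun w => ?_, fun w => ?_⟩
  · rw [triDet_eq_quadDet₁₂₄ _ U V W Z, triDet_eq_quadDet₁₂₄ _ U' V' W' Z']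
    exact key w.i w.j 0 w.k (by have := w.sum_eq; omega) w.i_lt w.j_lt
      (by have := w.i_lt; omega) w.k_lt
  · rw [triDet_eq_quadDet₂₃₄ _ U V W Z, triDet_eq_quadDet₂₃₄ _ U' V' W' Z']
    exact key 0 w.i w.j w.k (by have := w.sum_eq; omega) (by have := w.i_lt; omega)
      w.i_lt w.j_lt w.k_lt

/-- The flip from the diagonal `VZ` of the square `U V W Z` to the diagonal `UW`. -/
theorem IsTight.flip₂
    (hle : ∀ i j l, i + j + l ≤ m →
      (quadDet i j l U' V' W' Z').orderTop ≤ (quadDet i j l U V W Z).orderTop)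
    (h₁ : ∀ w, IsTight (triDet w U V Z) (triDet w U' V' Z'))
    (h₂ : ∀ w, IsTight (triDet w V W Z) (triDet w V' W' Z')) :
    (∀ w, IsTight (triDet w U V W) (triDet w U' V' W')) ∧
      ∀ w, IsTight (triDet w U W Z) (triDet w U' W' Z') := by
  -- The octahedron recurrence is invariant under rotating the square by one step.
  have key : ∀ h i j l, h + i + j + l = m → h < m → i < m → j < m → l < m →
      IsTight (quadDet i j l U V W Z) (quadDet i j l U' V' W' Z') := by
    intro h i j l hs hh hi hj hl
    refine IsTight.octahedron (m := m) (f := fun _ i j l => quadDet i j l U V W Z)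
      (f' := fun _ i j l => quadDet i j l U' V' W' Z')
      (fun h i j l hs => ?_) (fun h i j l hs => ?_)
      (fun h i j l hs => hle i j l (by omega)) ?_ ?_ hs hh hi hj hl
    · linear_combination quadDet_octahedron (h := h) (by omega : i + j + l + h + 2 = m) U V W Z
    · linear_combination
        quadDet_octahedron (h := h) (by omega : i + j + l + h + 2 = m) U' V' W' Z'
    · intro h i j hs hh hi hj
      have := h₁ ⟨i, j, h, by omega, hi, hj, hh⟩
      rwa [triDet_eq_quadDet₁₂₄ _ U V W Z, triDet_eq_quadDet₁₂₄ _ U' V' W' Z'] at this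
    · intro h j l hs hh hj hl
      have := h₂ ⟨j, l, h, by omega, hj, hl, hh⟩
      rwa [triDet_eq_quadDet₂₃₄ _ U V W Z, triDet_eq_quadDet₂₃₄ _ U' V' W' Z'] at this
  refine ⟨fun w => ?_, fun w => ?_⟩
  · rw [triDet_eq_quadDet₁₂₃ _ U V W Z, triDet_eq_quadDet₁₂₃ _ U' V' W' Z']
    exact key 0 w.i w.j w.k (by have := w.sum_eq; omega) (by have := w.i_lt; omega)
      w.i_lt w.j_lt w.k_lt
  · rw [triDet_eq_quadDet₁₃₄ _ U V W Z, triDet_eq_quadDet₁₃₄ _ U' V' W' Z']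
    exact key w.k w.i 0 w.j (by have := w.sum_eq; omega) w.k_lt w.i_lt
      (by have := w.i_lt; omega) w.j_lt

end Flip

/-- Tightness on the triangles of one triangulation implies tightness on all triangles. -/
theorem IsTight.of_triangulation {m n : ℕ} (T : Triangulation n)
    {g g' : Fin n → Matrix (Fin m) (Fin m) ℝ⸨X⸩}
    (hle : ∀ i j l, i + j + l ≤ m → ∀ p q r s,
      (quadDet i j l (g' p) (g' q) (g' r) (g' s)).orderTop ≤
        (quadDet i j l (g p) (g q) (g r) (g s)).orderTop)
    (hT : ∀ a ∈ T.chart m, IsTight (triDet a.w (g a.p) (g a.q) (g a.r))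
      (triDet a.w (g' a.p) (g' a.q) (g' a.r)))
    (a : CoordIdx m n) :
    IsTight (triDet a.w (g a.p) (g a.q) (g a.r)) (triDet a.w (g' a.p) (g' a.q) (g' a.r)) := by
  refine T.forall_of_flip
    (fun p q r => ∀ w, IsTight (triDet w (g p) (g q) (g r)) (triDet w (g' p) (g' q) (g' r)))
    (fun p q r s _ _ _ => IsTight.flip₁ fun i j l h => hle i j l h p q r s)
    (fun p q r s _ _ _ => IsTight.flip₂ fun i j l h => hle i j l h p q r s)
    ?_ a.p_lt_q a.q_lt_r a.w
  exact fun p q r hpq hqr h1 h2 h3 w => hT ⟨p, q, r, hpq, hqr, w⟩ ⟨h1, h2, h3⟩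

/-! ### Generic bases of lattices -/

theorem zero_le_orderTop_algebraMap (f : ℝ⟦X⟧) : 0 ≤ (algebraMap ℝ⟦X⟧ ℝ⸨X⸩ f).orderTop := by
  refine HahnSeries.le_orderTop_iff_forall.2 fun d hd => ?_
  have := PowerSeries.coeff_coe f d
  rw [if_pos (by exact_mod_cast hd)] at this
  exact this

/-- Some point, which can be taken real, minimizes the order of finitely many polynomials over
`ℝ((t))` simultaneously among all points over `ℝ[[t]]`: the coefficients of lowest order form a nonzero real polynomial,
and it is enough to avoid the zeros of these. -/
theorem exists_generic_point {σ ι : Type} [Finite ι] (P : ι → MvPolynomial σ ℝ⸨X⸩) :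
    ∃ x : σ → ℝ⟦X⟧, ∀ a, ∀ y : σ → ℝ⟦X⟧,
      (MvPolynomial.eval (fun s => algebraMap ℝ⟦X⟧ ℝ⸨X⸩ (x s)) (P a)).orderTop ≤
        (MvPolynomial.eval (fun s => algebraMap ℝ⟦X⟧ ℝ⸨X⸩ (y s)) (P a)).orderTop := by
  have single : ∀ P : MvPolynomial σ ℝ⸨X⸩, ∃ p : MvPolynomial σ ℝ, p ≠ 0 ∧
      ∀ x : σ → ℝ, MvPolynomial.eval x p ≠ 0 → ∀ y : σ → ℝ⟦X⟧,
      (MvPolynomial.eval (fun s => algebraMap ℝ⟦X⟧ ℝ⸨X⸩ (PowerSeries.C (x s))) P).orderTop ≤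
        (MvPolynomial.eval (fun s => algebraMap ℝ⟦X⟧ ℝ⸨X⸩ (y s)) P).orderTop := by
    intro P
    by_cases hP : P = 0
    · exact ⟨1, one_ne_zero, fun x _ y => by simp [hP]⟩
    have hne : P.support.Nonempty := by simpa [Finset.nonempty_iff_ne_empty] using hP
    obtain ⟨s₀, hs₀, hmin⟩ := P.support.exists_min_image (fun s => (P.coeff s).order) hne
    set N := (P.coeff s₀).order with hN
    let p : MvPolynomial σ ℝ := ∑ s ∈ P.support, MvPolynomial.monomial s ((P.coeff s).coeff N)
    refine ⟨p, fun h0 => ?_, fun x hx y => ?_⟩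
    · have h1 : p.coeff s₀ = (P.coeff s₀).coeff N := by
        classical
        simp only [p, MvPolynomial.coeff_sum, MvPolynomial.coeff_monomial]
        rw [Finset.sum_ite_eq' P.support s₀, if_pos hs₀]
      rw [h0, MvPolynomial.coeff_zero] at h1
      exact MvPolynomial.mem_support_iff.1 hs₀ (HahnSeries.coeff_order_eq_zero.1 h1.symm)
    · have hup : (MvPolynomial.eval
          (fun s => algebraMap ℝ⟦X⟧ ℝ⸨X⸩ (PowerSeries.C (x s))) P).orderTop ≤ (N : WithTop ℤ) := by
        refine HahnSeries.orderTop_le_of_coeff_ne_zero ?_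
        convert hx using 1
        rw [MvPolynomial.eval_eq]
        simp only [p, map_sum, MvPolynomial.eval_monomial, HahnSeries.coeff_sum]
        refine Finset.sum_congr rfl fun s _ => ?_
        have : ∏ i ∈ s.support, algebraMap ℝ⟦X⟧ ℝ⸨X⸩ (PowerSeries.C (x i)) ^ s i =
            HahnSeries.C (∏ i ∈ s.support, x i ^ s i) := by
          simp only [map_prod, map_pow]
          refine Finset.prod_congr rfl fun i _ => ?_
          congr 1
          exact HahnSeries.ofPowerSeries_C (x i)
        rw [this, mul_comm, HahnSeries.C_mul_eq_smul, HahnSeries.coeff_smul, smul_eq_mul, mul_comm]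
        rfl
      refine hup.trans ?_
      rw [MvPolynomial.eval_eq]
      refine (HahnSeries.addVal ℤ ℝ).map_le_sum fun s hs => ?_
      rw [HahnSeries.addVal_apply, orderTop_mul]
      simp only [← map_pow, ← map_prod]
      refine (le_of_eq (add_zero _).symm).trans (add_le_add ?_ (zero_le_orderTop_algebraMap _))
      rw [← HahnSeries.order_eq_orderTop_of_ne_zero (MvPolynomial.mem_support_iff.1 hs)]
      exact_mod_cast hmin s hs
  choose p hp hx using fun a => single (P a)
  have := Fintype.ofFinite ι
  obtain ⟨x, hx0⟩ : ∃ x, MvPolynomial.eval x (∏ a, p a) ≠ 0 := by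
    by_contra! h
    exact Finset.prod_ne_zero_iff.2 (fun a _ => hp a)
      (MvPolynomial.funext fun x => by rw [h x, map_zero])
  refine ⟨fun s => PowerSeries.C (x s), fun a y => hx a x ?_ y⟩
  rw [map_prod] at hx0
  exact Finset.prod_ne_zero_iff.1 hx0 a (Finset.mem_univ a)

/-- The lattices spanned by finitely many matrices contain tuples of vectors that make all determinants `det(u₁, …, v₁, …, w₁, …, z₁, …)`
of four of these tuples as large as they can be for vectors of the lattices. -/
theorem exists_generic_bases {m n : ℕ} (g : Fin n → Matrix (Fin m) (Fin m) ℝ⸨X⸩) :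
    ∃ x : Fin n → Matrix (Fin m) (Fin m) ℝ⟦X⟧, ∀ i j l, i + j + l ≤ m → ∀ p q r s,
      ∀ y : Fin n → Matrix (Fin m) (Fin m) ℝ⟦X⟧,
      (quadDet i j l (g p * (x p).map (algebraMap ℝ⟦X⟧ ℝ⸨X⸩))
        (g q * (x q).map (algebraMap ℝ⟦X⟧ ℝ⸨X⸩)) (g r * (x r).map (algebraMap ℝ⟦X⟧ ℝ⸨X⸩))
        (g s * (x s).map (algebraMap ℝ⟦X⟧ ℝ⸨X⸩))).orderTop ≤
      (quadDet i j l (g p * (y p).map (algebraMap ℝ⟦X⟧ ℝ⸨X⸩))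
        (g q * (y q).map (algebraMap ℝ⟦X⟧ ℝ⸨X⸩)) (g r * (y r).map (algebraMap ℝ⟦X⟧ ℝ⸨X⸩))
        (g s * (y s).map (algebraMap ℝ⟦X⟧ ℝ⸨X⸩))).orderTop := by
  let G : Fin n → Matrix (Fin m) (Fin m) (MvPolynomial (Fin n × Fin m × Fin m) ℝ⸨X⸩) :=
    fun p => (g p).map MvPolynomial.C * Matrix.of fun a b => MvPolynomial.X (p, a, b)
  obtain ⟨x, hx⟩ := exists_generic_point
    fun a : (Fin (m + 1) × Fin (m + 1) × Fin (m + 1)) × Fin n × Fin n × Fin n × Fin n =>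
      quadDet a.1.1 a.1.2.1 a.1.2.2 (G a.2.1) (G a.2.2.1) (G a.2.2.2.1) (G a.2.2.2.2)
  have hG : ∀ (y : Fin n × Fin m × Fin m → ℝ⟦X⟧) (p : Fin n),
      (G p).map (MvPolynomial.eval fun s => algebraMap ℝ⟦X⟧ ℝ⸨X⸩ (y s)) =
        g p * (Matrix.of fun a b => y (p, a, b)).map (algebraMap ℝ⟦X⟧ ℝ⸨X⸩) := by
    intro y p
    ext a b : 2
    simp [G, Matrix.mul_apply]
  have hP : ∀ (y : Fin n × Fin m × Fin m → ℝ⟦X⟧) (i j l : ℕ) (p q r s : Fin n),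
      MvPolynomial.eval (fun s => algebraMap ℝ⟦X⟧ ℝ⸨X⸩ (y s))
        (quadDet i j l (G p) (G q) (G r) (G s)) =
      quadDet i j l (g p * (Matrix.of fun a b => y (p, a, b)).map (algebraMap ℝ⟦X⟧ ℝ⸨X⸩))
        (g q * (Matrix.of fun a b => y (q, a, b)).map (algebraMap ℝ⟦X⟧ ℝ⸨X⸩))
        (g r * (Matrix.of fun a b => y (r, a, b)).map (algebraMap ℝ⟦X⟧ ℝ⸨X⸩))
        (g s * (Matrix.of fun a b => y (s, a, b)).map (algebraMap ℝ⟦X⟧ ℝ⸨X⸩)) := by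
    intro y i j l p q r s
    refine (quadDet_map (MvPolynomial.eval fun s => algebraMap ℝ⟦X⟧ ℝ⸨X⸩ (y s)) i j l
      (G p) (G q) (G r) (G s)).trans ?_
    rw [hG, hG, hG, hG]
  refine ⟨fun p => Matrix.of fun a b => x (p, a, b), fun i j l h p q r s y => ?_⟩
  have := hx ((⟨i, by omega⟩, ⟨j, by omega⟩, ⟨l, by omega⟩), p, q, r, s)
    (fun s => y s.1 s.2.1 s.2.2)
  exact (le_of_eq (congrArg _ (hP x i j l p q r s).symm)).trans
    (this.trans (le_of_eq (congrArg _ (hP _ i j l p q r s))))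

theorem mem_latticeOf {m : ℕ} {g : Matrix.SpecialLinearGroup (Fin m) ℝ⸨X⸩}
    {U : Matrix (Fin m) (Fin m) ℝ⸨X⸩} :
    (∀ c, (fun r => U r c) ∈ (latticeOf g).1) ↔
      ∃ h : Matrix (Fin m) (Fin m) ℝ⟦X⟧, U = g.1 * h.map (algebraMap ℝ⟦X⟧ ℝ⸨X⸩) := by
  simp only [latticeOf, columnSpan, Submodule.mem_span_range_iff_exists_fun]
  refine ⟨fun h => ?_, ?_⟩
  · choose y hy using h
    refine ⟨Matrix.of fun a b => y b a, ?_⟩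
    ext r c
    rw [← congrFun (hy c) r]
    simp [Matrix.mul_apply, Algebra.smul_def, mul_comm]
  · rintro ⟨h, rfl⟩ c
    refine ⟨fun a => h a c, ?_⟩
    ext r
    simp [Matrix.mul_apply, Algebra.smul_def, mul_comm]

/-- The tropical triple function of three lattices, computed on vectors that maximize it. -/
theorem tripleDist_eq {m : ℕ} (w : TriWeight m)
    (g₁ g₂ g₃ : Matrix.SpecialLinearGroup (Fin m) ℝ⸨X⸩) (x₁ x₂ x₃ : Matrix (Fin m) (Fin m) ℝ⟦X⟧)
    (hne : triDet w (g₁.1 * x₁.map (algebraMap ℝ⟦X⟧ ℝ⸨X⸩)) (g₂.1 * x₂.map (algebraMap ℝ⟦X⟧ ℝ⸨X⸩))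
      (g₃.1 * x₃.map (algebraMap ℝ⟦X⟧ ℝ⸨X⸩)) ≠ 0)
    (hmin : ∀ y₁ y₂ y₃ : Matrix (Fin m) (Fin m) ℝ⟦X⟧,
      (triDet w (g₁.1 * x₁.map (algebraMap ℝ⟦X⟧ ℝ⸨X⸩)) (g₂.1 * x₂.map (algebraMap ℝ⟦X⟧ ℝ⸨X⸩))
        (g₃.1 * x₃.map (algebraMap ℝ⟦X⟧ ℝ⸨X⸩))).orderTop ≤
      (triDet w (g₁.1 * y₁.map (algebraMap ℝ⟦X⟧ ℝ⸨X⸩)) (g₂.1 * y₂.map (algebraMap ℝ⟦X⟧ ℝ⸨X⸩))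
        (g₃.1 * y₃.map (algebraMap ℝ⟦X⟧ ℝ⸨X⸩))).orderTop) :
    tripleDist w (latticeOf g₁) (latticeOf g₂) (latticeOf g₃) =
      -(triDet w (g₁.1 * x₁.map (algebraMap ℝ⟦X⟧ ℝ⸨X⸩)) (g₂.1 * x₂.map (algebraMap ℝ⟦X⟧ ℝ⸨X⸩))
        (g₃.1 * x₃.map (algebraMap ℝ⟦X⟧ ℝ⸨X⸩))).order := by
  refine (tripleDist_isGreatest w _ _ _).unique ⟨?_, ?_⟩
  · exact ⟨_, _, _, mem_latticeOf.2 ⟨x₁, rfl⟩, mem_latticeOf.2 ⟨x₂, rfl⟩,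
      mem_latticeOf.2 ⟨x₃, rfl⟩, hne, rfl⟩
  · rintro d ⟨U, V, W, hU, hV, hW, h0, rfl⟩
    obtain ⟨y₁, rfl⟩ := mem_latticeOf.1 hU
    obtain ⟨y₂, rfl⟩ := mem_latticeOf.1 hV
    obtain ⟨y₃, rfl⟩ := mem_latticeOf.1 hW
    have := hmin y₁ y₂ y₃
    rw [← HahnSeries.order_eq_orderTop_of_ne_zero hne,
      ← HahnSeries.order_eq_orderTop_of_ne_zero h0, WithTop.coe_le_coe] at this
    exact neg_le_neg this

/-- Positivity and goodness of lifts may be tested on any triangulations: they imply the same for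
all triangles.  Goodness says that the minors of the given bases are as large as generic ones, which is a
tightness property. -/
theorem IsGoodLift.forall_triangles {m n : ℕ}
    {g : Fin n → Matrix.SpecialLinearGroup (Fin m) ℝ⸨X⸩} (T : Triangulation n)
    (hpos : ∀ a ∈ T.chart m, triDet a.w (g a.p).1 (g a.q).1 (g a.r).1 ∈ positiveLaurent)
    (hg : IsGoodLift g) (a : CoordIdx m n) :
    triDet a.w (g a.p).1 (g a.q).1 (g a.r).1 ∈ positiveLaurent ∧
      tripleDist a.w (latticeOf (g a.p)) (latticeOf (g a.q)) (latticeOf (g a.r)) =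
        -(triDet a.w (g a.p).1 (g a.q).1 (g a.r).1).order := by
  have hpos' : ∀ a : CoordIdx m n,
      triDet a.w (g a.p).1 (g a.q).1 (g a.r).1 ∈ positiveLaurent := fun a =>
    (IsTight.of_triangulation T (g := fun p => (g p).1) (g' := fun p => (g p).1)
      (fun _ _ _ _ _ _ _ _ => le_rfl) (fun a ha => ⟨hpos a ha, rfl⟩) a).1
  obtain ⟨x, hx⟩ := exists_generic_bases fun p => (g p).1
  set g' : Fin n → Matrix (Fin m) (Fin m) ℝ⸨X⸩ :=
    fun p => (g p).1 * (x p).map (algebraMap ℝ⟦X⟧ ℝ⸨X⸩) with hg'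
  have hle : ∀ i j l, i + j + l ≤ m → ∀ p q r s,
      (quadDet i j l (g' p) (g' q) (g' r) (g' s)).orderTop ≤
        (quadDet i j l (g p).1 (g q).1 (g r).1 (g s).1).orderTop := by
    intro i j l h p q r s
    simpa [hg'] using hx i j l h p q r s (fun _ => 1)
  have hne : ∀ a : CoordIdx m n, triDet a.w (g' a.p) (g' a.q) (g' a.r) ≠ 0 := by
    intro a h0
    have := hle a.w.i a.w.j a.w.k a.w.sum_eq.le a.p a.q a.r a.r
    rw [← triDet_eq_quadDet₁₂₃, ← triDet_eq_quadDet₁₂₃, h0, HahnSeries.orderTop_zero,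
      top_le_iff, HahnSeries.orderTop_eq_top] at this
    exact ne_zero_of_positiveLaurent (hpos' a) this
  have hdist : ∀ a : CoordIdx m n,
      tripleDist a.w (latticeOf (g a.p)) (latticeOf (g a.q)) (latticeOf (g a.r)) =
        -(triDet a.w (g' a.p) (g' a.q) (g' a.r)).order := by
    intro a
    refine tripleDist_eq _ _ _ _ _ _ _ (hne a) fun y₁ y₂ y₃ => ?_
    have hpq := a.p_lt_q
    have hqr := a.q_lt_r
    have := hx a.w.i a.w.j a.w.k a.w.sum_eq.le a.p a.q a.r a.r
      (fun p => if p = a.p then y₁ else if p = a.q then y₂ else y₃)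
    simpa only [← triDet_eq_quadDet₁₂₃, if_true, hpq.ne', hqr.ne', (hpq.trans hqr).ne',
      if_false] using this
  have hiff : ∀ a : CoordIdx m n,
      tripleDist a.w (latticeOf (g a.p)) (latticeOf (g a.q)) (latticeOf (g a.r)) =
        -(triDet a.w (g a.p).1 (g a.q).1 (g a.r).1).order ↔
      (triDet a.w (g' a.p) (g' a.q) (g' a.r)).orderTop =
        (triDet a.w (g a.p).1 (g a.q).1 (g a.r).1).orderTop := by
    intro a
    rw [hdist, neg_inj, ← HahnSeries.order_eq_orderTop_of_ne_zero (hne a),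
      ← HahnSeries.order_eq_orderTop_of_ne_zero (ne_zero_of_positiveLaurent (hpos' a)),
      WithTop.coe_inj]
  obtain ⟨T', hT'⟩ := hg
  refine ⟨hpos' a, (hiff a).2 ?_⟩
  exact (IsTight.of_triangulation T' (g := fun p => (g p).1) (g' := g') hle
    (fun a ha => ⟨hpos' a, (hiff a).1 (hT' a ha)⟩) a).2

/-! ### Tropicalization as asymptotics -/

section Asymptotics

open Filter Topology

/-- If each variable is asymptotic to `c t^{-v}` with `c > 0`, then so is the value of a
subtraction-free expression, with its tropicalization in place of `v`. -/
theorem SubtractionFree.tendsto_eval {ι : Type} {φ : ℝ → ι → ℝ} {v : ι → ℤ}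
    (hφ : ∀ a, ∃ c : ℝ, 0 < c ∧ Tendsto (fun t => φ t a * t ^ v a) (𝓝[>] 0) (𝓝 c))
    (P : SubtractionFree ι) :
    ∃ c : ℝ, 0 < c ∧ Tendsto (fun t => P.eval (φ t) * t ^ P.trop v) (𝓝[>] 0) (𝓝 c) := by
  have hpos : ∀ᶠ t : ℝ in 𝓝[>] 0, 0 < t := eventually_mem_nhdsWithin
  have hzpow : ∀ d : ℤ, 0 ≤ d →
      Tendsto (fun t : ℝ => t ^ d) (𝓝[>] 0) (𝓝 (if d = 0 then 1 else 0)) := by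
    intro d hd
    obtain ⟨n, rfl⟩ := Int.eq_ofNat_of_zero_le hd
    have h : Tendsto (fun t : ℝ => t ^ n) (𝓝[>] 0) (𝓝 (0 ^ n)) :=
      ((continuous_pow n).tendsto 0).mono_left nhdsWithin_le_nhds
    simpa [zero_pow_eq] using h
  induction P with
  | var a => exact hφ a
  | one => exact ⟨1, one_pos, by simp [SubtractionFree.eval, SubtractionFree.trop]⟩
  | add P Q hP hQ =>
    obtain ⟨c, hc, hP⟩ := hP
    obtain ⟨d, hd, hQ⟩ := hQ
    set p := P.trop v
    set q := Q.trop v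
    refine ⟨c * (if max p q - p = 0 then 1 else 0) + d * (if max p q - q = 0 then 1 else 0), ?_, ?_⟩
    · rcases le_total p q with h | h
      · rw [max_eq_right h, sub_self, if_pos rfl, mul_one]
        split_ifs <;> simp [hd, add_pos hc hd]
      · rw [max_eq_left h, sub_self, if_pos rfl, mul_one]
        split_ifs <;> simp [hc, add_pos hc hd]
    · refine ((hP.mul (hzpow (max p q - p) (by simp))).add
        (hQ.mul (hzpow (max p q - q) (by simp)))).congr' ?_
      filter_upwards [hpos] with t ht
      rw [mul_assoc, mul_assoc, ← zpow_add₀ ht.ne', ← zpow_add₀ ht.ne', add_sub_cancel,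
        add_sub_cancel, ← add_mul]
      rfl
  | mul P Q hP hQ =>
    obtain ⟨c, hc, hP⟩ := hP
    obtain ⟨d, hd, hQ⟩ := hQ
    refine ⟨c * d, mul_pos hc hd, (hP.mul hQ).congr' ?_⟩
    filter_upwards [hpos] with t ht
    rw [SubtractionFree.eval, SubtractionFree.trop, zpow_add₀ ht.ne']
    ring
  | div P Q hP hQ =>
    obtain ⟨c, hc, hP⟩ := hP
    obtain ⟨d, hd, hQ⟩ := hQ
    refine ⟨c / d, div_pos hc hd, (hP.div hQ hd.ne').congr' ?_⟩
    filter_upwards [hpos] with t ht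
    rw [SubtractionFree.eval, SubtractionFree.trop, zpow_sub₀ ht.ne', ← mul_div_mul_comm]
    rfl

theorem zpow_asymptotics_le {f : ℝ → ℝ} {a b : ℤ} {c d : ℝ} (hc : 0 < c)
    (ha : Tendsto (fun t => f t * t ^ a) (𝓝[>] 0) (𝓝 c))
    (hb : Tendsto (fun t => f t * t ^ b) (𝓝[>] 0) (𝓝 d)) : a ≤ b := by
  by_contra! hlt
  have hpos : ∀ᶠ t : ℝ in 𝓝[>] 0, 0 < t := eventually_mem_nhdsWithin
  obtain ⟨n, hn⟩ := Int.eq_ofNat_of_zero_le (sub_nonneg.2 hlt.le)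
  have h : Tendsto (fun t : ℝ => t ^ n) (𝓝[>] 0) (𝓝 (0 ^ n)) :=
    ((continuous_pow n).tendsto 0).mono_left nhdsWithin_le_nhds
  rw [zero_pow (by omega)] at h
  have h' := hb.mul h
  rw [mul_zero] at h'
  refine hc.ne (tendsto_nhds_unique (h'.congr' ?_) ha)
  filter_upwards [hpos] with t ht
  rw [mul_assoc, ← zpow_natCast, ← zpow_add₀ ht.ne']
  congr 2
  omega

theorem zpow_asymptotics_unique {f : ℝ → ℝ} {a b : ℤ} {c d : ℝ} (hc : 0 < c) (hd : 0 < d)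
    (ha : Tendsto (fun t => f t * t ^ a) (𝓝[>] 0) (𝓝 c))
    (hb : Tendsto (fun t => f t * t ^ b) (𝓝[>] 0) (𝓝 d)) : a = b :=
  le_antisymm (zpow_asymptotics_le hc ha hb) (zpow_asymptotics_le hd hb ha)

theorem tendsto_polynomial_div_pow {q : Polynomial ℝ} {d : ℕ} (hq : ∀ e < d, q.coeff e = 0) :
    Tendsto (fun t => q.eval t * t ^ (-(d : ℤ))) (𝓝[>] 0) (𝓝 (q.coeff d)) := by
  obtain ⟨r, rfl⟩ := Polynomial.X_pow_dvd_iff.2 hq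
  have h : Tendsto (fun t => r.eval t) (𝓝[>] 0) (𝓝 (r.eval 0)) :=
    (r.continuous.tendsto 0).mono_left nhdsWithin_le_nhds
  rw [Polynomial.coeff_X_pow_mul', if_pos le_rfl, Nat.sub_self, Polynomial.coeff_zero_eq_eval_zero]
  refine h.congr' ?_
  filter_upwards [eventually_mem_nhdsWithin] with t ht
  have ht : (0 : ℝ) < t := ht
  have : t ^ d ≠ 0 := (pow_pos ht d).ne'
  simp only [Polynomial.eval_mul, Polynomial.eval_pow, Polynomial.eval_X, zpow_neg, zpow_natCast]
  field_simp

/-! ### Real points near a Laurent point -/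

/-- Truncating the entries of a matrix modulo `X^N` changes its determinant by a multiple
of `X^N`. -/
theorem coeff_det_trunc {m : ℕ} {S : Matrix (Fin m) (Fin m) ℝ⟦X⟧} {N d : ℕ} (hd : d < N) :
    (S.map (PowerSeries.trunc N)).det.coeff d = PowerSeries.coeff d S.det := by
  let I : Ideal ℝ⟦X⟧ := Ideal.span {PowerSeries.X ^ N}
  have h : Ideal.Quotient.mk I ((S.map (PowerSeries.trunc N)).det : ℝ⟦X⟧) =
      Ideal.Quotient.mk I S.det := by
    have e : ((S.map (PowerSeries.trunc N)).det : ℝ⟦X⟧) =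
      Polynomial.coeToPowerSeries.ringHom (S.map (PowerSeries.trunc N)).det := rfl
    rw [e, RingHom.map_det, RingHom.map_det, RingHom.map_det]
    congr 1
    ext r c
    simp only [RingHom.mapMatrix_apply, Matrix.map_apply]
    rw [Ideal.Quotient.mk_eq_mk_iff_sub_mem, Ideal.mem_span_singleton, PowerSeries.X_pow_dvd_iff]
    intro e he
    simp [PowerSeries.coeff_trunc, he]
  rw [Ideal.Quotient.mk_eq_mk_iff_sub_mem, Ideal.mem_span_singleton,
    PowerSeries.X_pow_dvd_iff] at h
  have := h d hd
  rwa [map_sub, Polynomial.coeff_coe, sub_eq_zero] at this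

/-- Clearing denominators by `t^M` shifts the determinant of an `m × m` matrix by `M m`. -/
theorem coeff_det_of_map_eq {m M : ℕ} {A : Matrix (Fin m) (Fin m) ℝ⸨X⸩}
    {S : Matrix (Fin m) (Fin m) ℝ⟦X⟧}
    (hS : S.map (algebraMap ℝ⟦X⟧ ℝ⸨X⸩) = (algebraMap ℝ⟦X⟧ ℝ⸨X⸩ PowerSeries.X) ^ M • A) (d : ℤ) :
    A.det.coeff (d - M * m) = if d < 0 then 0 else PowerSeries.coeff d.natAbs S.det := by
  have h : algebraMap ℝ⟦X⟧ ℝ⸨X⸩ S.det = HahnSeries.single ((M * m : ℕ) : ℤ) 1 * A.det := by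
    rw [RingHom.map_det, RingHom.mapMatrix_apply, hS, Matrix.det_smul, Fintype.card_fin, ← pow_mul,
      ← map_pow]
    congr 1
    exact HahnSeries.ofPowerSeries_X_pow (M * m)
  have h2 := PowerSeries.coeff_coe S.det d
  change (algebraMap ℝ⟦X⟧ ℝ⸨X⸩ S.det).coeff d = _ at h2
  rw [← h2, h, ← sub_add_cancel d ((M * m : ℕ) : ℤ), HahnSeries.coeff_single_mul_add, one_mul]
  push_cast
  rw [sub_add_cancel]

/-- The determinant of a matrix of sufficiently long truncations, evaluated at small `t > 0`, is
asymptotic to the leading term of the determinant. -/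
theorem tendsto_det_trunc {m M N : ℕ} {A : Matrix (Fin m) (Fin m) ℝ⸨X⸩}
    {S : Matrix (Fin m) (Fin m) ℝ⟦X⟧}
    (hS : S.map (algebraMap ℝ⟦X⟧ ℝ⸨X⸩) = (algebraMap ℝ⟦X⟧ ℝ⸨X⸩ PowerSeries.X) ^ M • A)
    (h0 : A.det ≠ 0) (hN : A.det.order + M * m < N) :
    Tendsto (fun t => (t ^ (-(M : ℤ)) • (S.map (PowerSeries.trunc N)).map (Polynomial.eval t)).det *
      t ^ (-A.det.order)) (𝓝[>] 0) (𝓝 A.det.leadingCoeff) := by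
  have hlead : A.det.leadingCoeff ≠ 0 := HahnSeries.leadingCoeff_ne_zero.2 h0
  rw [HahnSeries.leadingCoeff_eq] at hlead ⊢
  have h1 := coeff_det_of_map_eq hS (A.det.order + M * m)
  rw [add_sub_cancel_right] at h1
  obtain ⟨d, hd⟩ : ∃ d : ℕ, A.det.order + M * m = d := by
    refine Int.eq_ofNat_of_zero_le ?_
    by_contra! hlt
    rw [if_pos hlt] at h1
    exact hlead h1
  rw [hd, if_neg (by omega), Int.natAbs_natCast] at h1
  rw [h1, ← coeff_det_trunc (N := N) (by omega)]
  refine (tendsto_polynomial_div_pow fun e he => ?_).congr' ?_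
  · rw [coeff_det_trunc (by omega)]
    have h2 := coeff_det_of_map_eq hS e
    rw [if_neg (by omega), Int.natAbs_natCast] at h2
    rw [← h2]
    exact HahnSeries.coeff_eq_zero_of_lt_order (by omega)
  · filter_upwards [eventually_mem_nhdsWithin] with t ht
    have ht : (0 : ℝ) < t := ht
    rw [Matrix.det_smul, Fintype.card_fin, mul_right_comm, ← zpow_natCast, ← zpow_mul,
      ← zpow_add₀ ht.ne', mul_comm]
    congr 1
    · congr 1
      rw [← hd]; ring
    · exact RingHom.map_det (Polynomial.evalRingHom t) _

/-- Rescaling the last column of an invertible matrix makes its determinant one. -/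
theorem exists_specialLinear_of_det_ne_zero {m : ℕ} {A : Matrix (Fin m) (Fin m) ℝ}
    (h : A.det ≠ 0) :
    ∃ B : Matrix.SpecialLinearGroup (Fin m) ℝ, ∀ r c : Fin m, c.1 + 1 < m → B.1 r c = A r c := by
  rcases m with _ | m
  · exact ⟨1, fun r => r.elim0⟩
  refine ⟨⟨A.updateCol (Fin.last m) (A.det⁻¹ • fun r => A r (Fin.last m)), ?_⟩, fun r c hc => ?_⟩
  · rw [Matrix.det_updateCol_smul]
    have : A.updateCol (Fin.last m) (fun r => A r (Fin.last m)) = A := A.updateCol_eq_self _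
    rw [this, inv_mul_cancel₀ h]
  · exact Matrix.updateCol_ne fun hl => by simp [hl] at hc

/-- The last columns do not enter, since all three weights are less than `m`. -/
theorem triDet_congr {m : ℕ} {k : Type} [CommRing k] (w : TriWeight m)
    {U V W U' V' W' : Matrix (Fin m) (Fin m) k} (hU : ∀ r c : Fin m, c.1 + 1 < m → U r c = U' r c)
    (hV : ∀ r c : Fin m, c.1 + 1 < m → V r c = V' r c)
    (hW : ∀ r c : Fin m, c.1 + 1 < m → W r c = W' r c) : triDet w U V W = triDet w U' V' W' := by
  have := w.sum_eq
  have := w.i_lt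
  have := w.j_lt
  have := w.k_lt
  simp only [triDet]
  congr 1
  ext r c
  simp only [triMatrix]
  split_ifs
  · exact hU r c (by omega)
  · exact hV r _ (by simp only []; omega)
  · exact hW r _ (by simp only []; omega)

instance CoordIdx.finite (m n : ℕ) : Finite (CoordIdx m n) := by
  refine Finite.of_injective (β := Fin n × Fin n × Fin n × Fin m × Fin m × Fin m)
    (fun a => (a.p, a.q, a.r, ⟨a.w.i, a.w.i_lt⟩, ⟨a.w.j, a.w.j_lt⟩, ⟨a.w.k, a.w.k_lt⟩)) ?_
  rintro ⟨p, q, r, _, _, i, j, k, _, _, _, _⟩ ⟨p', q', r', _, _, i', j', k', _, _, _, _⟩ h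
  simp only [Prod.mk.injEq, Fin.mk.injEq] at h
  obtain ⟨rfl, rfl, rfl, rfl, rfl, rfl⟩ := h
  rfl

/-- A configuration of flags over `ℝ((t))` in general position is approximated by real
configurations depending on a small parameter `t > 0`: their coordinates are asymptotic to the
leading terms of the given ones.  Determinant one is restored by rescaling the last column of each
lift, which does not enter the coordinates. -/
theorem exists_real_approximation {m n : ℕ} (g : Fin n → Matrix.SpecialLinearGroup (Fin m) ℝ⸨X⸩)
    (hg : ∀ a : CoordIdx m n, triDet a.w (g a.p).1 (g a.q).1 (g a.r).1 ≠ 0) :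
    ∃ G : ℝ → Fin n → Matrix.SpecialLinearGroup (Fin m) ℝ, ∀ a : CoordIdx m n,
      Tendsto (fun t => triDet a.w (G t a.p).1 (G t a.q).1 (G t a.r).1 *
          t ^ (-(triDet a.w (g a.p).1 (g a.q).1 (g a.r).1).order)) (𝓝[>] 0)
        (𝓝 (triDet a.w (g a.p).1 (g a.q).1 (g a.r).1).leadingCoeff) := by
  classical
  obtain ⟨M, hM⟩ := exists_pow_mul_mem
    fun b : Fin n × Fin m × Fin m => (g b.1).1 b.2.1 b.2.2
  choose s hs using hM
  let S : Fin n → Matrix (Fin m) (Fin m) ℝ⟦X⟧ := fun p => Matrix.of fun a b => s (p, a, b)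
  have hS : ∀ p, (S p).map (algebraMap ℝ⟦X⟧ ℝ⸨X⸩) =
      (algebraMap ℝ⟦X⟧ ℝ⸨X⸩ PowerSeries.X) ^ M • (g p).1 := by
    intro p
    refine Matrix.ext fun a b => ?_
    exact hs (p, a, b)
  obtain ⟨B, hB⟩ := (Set.finite_range fun a : CoordIdx m n =>
    (triDet a.w (g a.p).1 (g a.q).1 (g a.r).1).order).bddAbove
  -- Beyond the leading terms of all coordinates and of the determinants of the lifts.
  let N : ℕ := B.toNat + M * m + 1
  let R : ℝ → Fin n → Matrix (Fin m) (Fin m) ℝ := fun t p =>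
    t ^ (-(M : ℤ)) • ((S p).map (PowerSeries.trunc N)).map (Polynomial.eval t)
  have hR : ∀ p, ∀ᶠ t in 𝓝[>] 0, (R t p).det ≠ 0 := by
    intro p
    have h := tendsto_det_trunc (N := N) (hS p) (by rw [(g p).2]; exact one_ne_zero)
      (by rw [(g p).2, HahnSeries.order_one]; push_cast [N]; omega)
    rw [(g p).2, HahnSeries.order_one, HahnSeries.leadingCoeff_one] at h
    filter_upwards [h.eventually_ne one_ne_zero] with t ht h0
    exact ht (mul_eq_zero_of_left h0 _)
  have hG : ∀ t p, ∃ G : Matrix.SpecialLinearGroup (Fin m) ℝ, (R t p).det ≠ 0 →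
      ∀ r c : Fin m, c.1 + 1 < m → G.1 r c = R t p r c := by
    intro t p
    by_cases h : (R t p).det = 0
    · exact ⟨1, fun h' => absurd h h'⟩
    · obtain ⟨G, hG⟩ := exists_specialLinear_of_det_ne_zero h
      exact ⟨G, fun _ => hG⟩
  choose G hG using hG
  refine ⟨G, fun a => ?_⟩
  have h := tendsto_det_trunc (N := N) (M := M)
    (S := triMatrix a.w (S a.p) (S a.q) (S a.r))
    (A := triMatrix a.w (g a.p).1 (g a.q).1 (g a.r).1) (by
      refine Matrix.ext fun r c => ?_
      have h1 := fun c => congrFun (congrFun (hS a.p) r) c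
      have h2 := fun c => congrFun (congrFun (hS a.q) r) c
      have h3 := fun c => congrFun (congrFun (hS a.r) r) c
      simp only [Matrix.map_apply, Matrix.smul_apply] at h1 h2 h3
      simp only [Matrix.map_apply, Matrix.smul_apply, triMatrix]
      split_ifs
      · exact h1 _
      · exact h2 _
      · exact h3 _) (hg a)
    (by
      have : (triDet a.w (g a.p).1 (g a.q).1 (g a.r).1).order ≤ B := hB ⟨a, rfl⟩
      simp only [triDet] at this
      push_cast [N]
      omega)
  refine Tendsto.congr' ?_ h
  filter_upwards [hR a.p, hR a.q, hR a.r] with t h1 h2 h3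
  rw [triDet_congr a.w (hG t _ h1) (hG t _ h2) (hG t _ h3)]
  simp only [triDet]
  congr 2
  ext r c
  simp only [R, triMatrix, Matrix.smul_apply, Matrix.map_apply]
  split_ifs <;> rfl

end Asymptotics

/-! ### The torus action -/

theorem Coweight.neg_neg {m : ℕ} (l : Coweight m) : - -l = l :=
  Subtype.ext (funext fun c => _root_.neg_neg (l.1 c))

theorem Coweight.pair_neg {m : ℕ} (l : Coweight m) (i : ℕ) : (-l).pair i = -l.pair i := by
  rw [Coweight.pair, Coweight.pair, ← Finset.sum_neg_distrib]
  refine Finset.sum_congr rfl fun c _ => ?_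
  split_ifs
  · rfl
  · rfl

theorem Coweight.torus_mul_torus_neg {m : ℕ} (l : Coweight m) : l.torus * (-l).torus = 1 := by
  refine Subtype.ext ?_
  rw [Matrix.SpecialLinearGroup.coe_mul, Matrix.SpecialLinearGroup.coe_one, torus, torus,
    Matrix.diagonal_mul_diagonal, ← Matrix.diagonal_one]
  congr 1
  funext c
  have : (-l).1 c = -l.1 c := rfl
  rw [HahnSeries.single_mul_single, this, add_neg_cancel, mul_one]
  rfl

theorem Coweight.pair_eq_sum_range {m : ℕ} (l : Coweight m) {i : ℕ} (hi : i ≤ m) :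
    l.pair i = ∑ c ∈ Finset.range i, if h : c < m then l.1 ⟨c, h⟩ else 0 := by
  let l' : ℕ → ℤ := fun c => if c < i then (if h : c < m then l.1 ⟨c, h⟩ else 0) else 0
  have h1 : l.pair i = ∑ c : Fin m, l' c.1 := by
    refine Finset.sum_congr rfl fun c _ => ?_
    simp [l']
  rw [h1, Fin.sum_univ_eq_sum_range]
  simp only [l']
  rw [← Finset.sum_filter]
  refine Finset.sum_congr ?_ fun _ _ => rfl
  ext c
  simp only [Finset.mem_filter, Finset.mem_range]
  omega

/-- Acting by the torus multiplies the coordinates by monomials. -/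
theorem triDet_mul_torus {m : ℕ} (w : TriWeight m) (U V W : Matrix (Fin m) (Fin m) ℝ⸨X⸩)
    (l₁ l₂ l₃ : Coweight m) :
    triDet w (U * l₁.torus.1) (V * l₂.torus.1) (W * l₃.torus.1) =
      HahnSeries.single (-(l₁.pair w.i + l₂.pair w.j + l₃.pair w.k)) 1 * triDet w U V W := by
  have hs := w.sum_eq
  let e : Fin m → ℤ := fun c =>
    if c.1 < w.i then l₁.1 c
    else if c.1 < w.i + w.j then l₂.1 ⟨c.1 - w.i, lt_of_le_of_lt (Nat.sub_le _ _) c.2⟩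
    else l₃.1 ⟨c.1 - (w.i + w.j), lt_of_le_of_lt (Nat.sub_le _ _) c.2⟩
  have hM : triMatrix w (U * l₁.torus.1) (V * l₂.torus.1) (W * l₃.torus.1) =
      Matrix.of fun r c => HahnSeries.single (-e c) 1 * triMatrix w U V W r c := by
    refine Matrix.ext fun r c => ?_
    simp only [triMatrix, Matrix.of_apply, e, Coweight.torus, Matrix.mul_diagonal]
    split_ifs <;> rw [mul_comm]
  have he : ∑ c, e c = l₁.pair w.i + l₂.pair w.j + l₃.pair w.k := by
    let e' : ℕ → ℤ := fun c => if h : c < m then e ⟨c, h⟩ else 0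
    have h1 : ∑ c, e c = ∑ c : Fin m, e' c.1 := by
      refine Finset.sum_congr rfl fun c _ => ?_
      simp [e']
    rw [h1, Fin.sum_univ_eq_sum_range,
      show Finset.range m = Finset.range (w.i + w.j + w.k) by rw [hs], Finset.sum_range_add, Finset.sum_range_add,
      l₁.pair_eq_sum_range (by omega), l₂.pair_eq_sum_range (by omega),
      l₃.pair_eq_sum_range (by omega)]
    congr 1
    · congr 1
      · refine Finset.sum_congr rfl fun c hc => ?_
        have hc := Finset.mem_range.1 hc
        simp [e', e, hc]
      · refine Finset.sum_congr rfl fun c hc => ?_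
        have hc := Finset.mem_range.1 hc
        simp [e', e, hc, show w.i + c < m by omega, show c < m by omega]
    · refine Finset.sum_congr rfl fun c hc => ?_
      have hc := Finset.mem_range.1 hc
      simp [e', e, show w.i + w.j + c < m by omega, show c < m by omega,
        show ¬ w.i + w.j + c < w.i by omega]
  rw [triDet, hM, Matrix.det_mul_row, prod_single, Finset.sum_neg_distrib, he, triDet]

theorem order_single_mul {f : ℝ⸨X⸩} (hf : f ≠ 0) (d : ℤ) :
    (HahnSeries.single d 1 * f).order = d + f.order := by
  rw [HahnSeries.order_mul (HahnSeries.single_ne_zero one_ne_zero) hf,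
    HahnSeries.order_single one_ne_zero]

theorem single_mul_mem_positiveLaurent {f : ℝ⸨X⸩} {d : ℤ} :
    HahnSeries.single d 1 * f ∈ positiveLaurent ↔ f ∈ positiveLaurent := by
  change 0 < (HahnSeries.single d 1 * f).leadingCoeff ↔ 0 < f.leadingCoeff
  rw [HahnSeries.leadingCoeff_mul, HahnSeries.leadingCoeff_of_single, one_mul]

/-! ### Families of virtual positive configurations -/

/-- A virtual positive configuration belongs to the family of some configuration of flags: its
points come from some flags and coweights, and the torus moves these coweights to any others. -/
theorem VirtualPositiveConfiguration.exists_inFamily {m n : ℕ}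
    (C : VirtualPositiveConfiguration m n) :
    ∃ F : Fin n → PrincipalFlag m ℝ⸨X⸩, InFamily F C.point C.coweight := by
  obtain ⟨F, l, ⟨T, hT⟩, g, hgF, hgood, hx⟩ := C.positive
  have hlift : ∀ i, g i * (- -l i).torus * (C.coweight i).torus * (-C.coweight i).torus =
      g i * (- -l i).torus := fun i => by
    rw [mul_assoc, Coweight.torus_mul_torus_neg, mul_one]
  refine ⟨fun i => ((g i * (- -l i).torus * (C.coweight i).torus :
      Matrix.SpecialLinearGroup (Fin m) ℝ⸨X⸩) : PrincipalFlag m ℝ⸨X⸩),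
    ⟨T, fun a ha => ?_⟩, fun i => g i * (- -l i).torus * (C.coweight i).torus,
    fun _ => rfl, by simpa only [hlift] using hgood, fun i => by rw [hx i, hlift i]⟩
  have h := hT a ha
  simp only [flagCoord, ← hgF, flagTriple_mk] at h
  simp only [flagCoord, flagTriple_mk, Matrix.SpecialLinearGroup.coe_mul, triDet_mul_torus,
    single_mul_mem_positiveLaurent]
  exact h

/-- All coordinates of the flags are positive, and their orders are the extended tropical
coordinates. -/
theorem InFamily.flagCoord {m n : ℕ} {C : VirtualPositiveConfiguration m n}
    {F : Fin n → PrincipalFlag m ℝ⸨X⸩} (h : InFamily F C.point C.coweight) (a : CoordIdx m n) :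
    flagCoord F a ∈ positiveLaurent ∧ C.triple a = -(HigherLaminations.flagCoord F a).order := by
  obtain ⟨⟨T, hT⟩, g, hgF, hgood, hx⟩ := h
  have hF : ∀ a, HigherLaminations.flagCoord F a = triDet a.w (g a.p).1 (g a.q).1 (g a.r).1 := by
    intro a
    simp only [HigherLaminations.flagCoord, ← hgF, flagTriple_mk]
  have htorus : ∀ a : CoordIdx m n,
      triDet a.w (g a.p * (-C.coweight a.p).torus).1 (g a.q * (-C.coweight a.q).torus).1
        (g a.r * (-C.coweight a.r).torus).1 =
      HahnSeries.single ((C.coweight a.p).pair a.w.i + (C.coweight a.q).pair a.w.j +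
        (C.coweight a.r).pair a.w.k) 1 * HigherLaminations.flagCoord F a := by
    intro a
    simp only [hF, Matrix.SpecialLinearGroup.coe_mul, triDet_mul_torus, Coweight.pair_neg,
      neg_add, _root_.neg_neg]
  obtain ⟨h1, h2⟩ := hgood.forall_triangles T
    (fun a ha => by rw [htorus, single_mul_mem_positiveLaurent]; exact hT a ha) a
  rw [htorus, single_mul_mem_positiveLaurent] at h1
  refine ⟨h1, ?_⟩
  rw [htorus, order_single_mul (ne_zero_of_positiveLaurent h1)] at h2
  rw [VirtualPositiveConfiguration.triple, hx, hx, hx, h2]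
  ring

/-! ### Tropical relations -/

open Filter Topology in
/-- Relations on real positive configurations tropicalize at the orders of a positive configuration
over `ℝ((t))`: evaluate both sides on real configurations that approximate it and compare the
orders of growth as `t → 0`. -/
theorem IsRelation.trop_eq {m n : ℕ} {P Q : SubtractionFree (CoordIdx m n)} (h : IsRelation P Q)
    (T : Triangulation n) {F : Fin n → PrincipalFlag m ℝ⸨X⸩}
    (hF : ∀ a, flagCoord F a ∈ positiveLaurent) :
    P.trop (fun a => -(flagCoord F a).order) = Q.trop (fun a => -(flagCoord F a).order) := by
  choose g hg using fun p => QuotientGroup.mk_surjective (F p)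
  obtain rfl : (fun p => (g p : PrincipalFlag m ℝ⸨X⸩)) = F := funext hg
  obtain ⟨G, hG⟩ := exists_real_approximation g fun a => ne_zero_of_positiveLaurent (hF a)
  let φ : ℝ → CoordIdx m n → ℝ := fun t =>
    flagCoord fun p => (G t p : PrincipalFlag m ℝ)
  have hφ : ∀ a, ∃ c : ℝ, 0 < c ∧ Tendsto (fun t => φ t a *
      t ^ (-(flagCoord (fun p => (g p : PrincipalFlag m ℝ⸨X⸩)) a).order)) (𝓝[>] 0) (𝓝 c) :=
    fun a => ⟨_, hF a, hG a⟩
  obtain ⟨c, hc, hP⟩ := P.tendsto_eval hφ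
  obtain ⟨d, hd, hQ⟩ := Q.tendsto_eval hφ
  refine zpow_asymptotics_unique hc hd hP (hQ.congr' ?_)
  have hpos : ∀ᶠ t in 𝓝[>] 0, ∀ a, 0 < φ t a := by
    refine eventually_all.2 fun a => ?_
    obtain ⟨c, hc, h⟩ := hφ a
    filter_upwards [h.eventually_const_lt hc, eventually_mem_nhdsWithin] with t ht ht0
    exact pos_of_mul_pos_left ht (zpow_pos ht0 _).le
  filter_upwards [hpos] with t ht
  rw [← h (fun p => (G t p : PrincipalFlag m ℝ)) ⟨T, fun a _ => ht a⟩]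

/-- Renaming of variables. -/
def SubtractionFree.map {ι κ : Type} (f : ι → κ) : SubtractionFree ι → SubtractionFree κ
  | .var a => .var (f a)
  | .one => .one
  | .add P Q => .add (P.map f) (Q.map f)
  | .mul P Q => .mul (P.map f) (Q.map f)
  | .div P Q => .div (P.map f) (Q.map f)

theorem SubtractionFree.eval_map {ι κ k : Type} [Field k] (f : ι → κ) (v : κ → k)
    (P : SubtractionFree ι) : (P.map f).eval v = P.eval (fun a => v (f a)) := by
  induction P with
  | var a => rfl
  | one => rfl
  | add P Q hP hQ => simp only [map, eval, hP, hQ]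
  | mul P Q hP hQ => simp only [map, eval, hP, hQ]
  | div P Q hP hQ => simp only [map, eval, hP, hQ]

theorem SubtractionFree.trop_map {ι κ : Type} (f : ι → κ) (v : κ → ℤ)
    (P : SubtractionFree ι) : (P.map f).trop v = P.trop (fun a => v (f a)) := by
  induction P with
  | var a => rfl
  | one => rfl
  | add P Q hP hQ => simp only [map, trop, hP, hQ]
  | mul P Q hP hQ => simp only [map, trop, hP, hQ]
  | div P Q hP hQ => simp only [map, trop, hP, hQ]

end HigherLaminations

open HigherLaminations in
theorem mainTheorem7 (m n : ℕ) (hm : 2 ≤ m) (hn : 3 ≤ n)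
    (C : VirtualPositiveConfiguration m n) :
    (∀ P Q : SubtractionFree (CoordIdx m n), IsRelation P Q → P.trop C.triple = Q.trop C.triple) ∧
    (∃ x : TropicalPoint m n, ∀ (T : Triangulation n) (a : T.chart m),
      x.coord T a = C.triple a.1) ∧
    (∃ F : Fin n → PrincipalFlag m (LaurentSeries ℝ), InFamily F C.point C.coweight) ∧
    (∀ F : Fin n → PrincipalFlag m (LaurentSeries ℝ), InFamily F C.point C.coweight →
      ∀ a : CoordIdx m n, flagCoord F a ∈ positiveLaurent ∧
        C.triple a = -(flagCoord F a).order) := by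
  obtain ⟨F, hF⟩ := C.exists_inFamily
  obtain ⟨T, -⟩ := hF.1
  have hrel : ∀ P Q : SubtractionFree (CoordIdx m n), IsRelation P Q →
      P.trop C.triple = Q.trop C.triple := by
    intro P Q h
    rw [show C.triple = fun a => -(flagCoord F a).order from funext fun a => (hF.flagCoord a).2]
    exact h.trop_eq T fun a => (hF.flagCoord a).1
  refine ⟨hrel, ⟨⟨fun _ a => C.triple a.1, fun T T' a R hR => ?_⟩, fun _ _ => rfl⟩, ⟨F, hF⟩,
    fun F hF a => hF.flagCoord a⟩
  rw [← SubtractionFree.trop_map Subtype.val C.triple R]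
  -- A transition function is a relation between a coordinate and an expression in a chart.
  refine hrel (.var a.1) (R.map Subtype.val) fun F hF => ?_
  rw [SubtractionFree.eval_map]
  exact hR F hF
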